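/- All graphs are finite, simple and connected. The total distance $W(\Gamma)$ is the sum of the distances over all unordered pairs of vertices of $\Gamma$, and a vertex $v$ of $\Gamma$ is a Šoltés vertex if $\Gamma\setminus v$ is connected and $W(\Gamma\setminus v)=W(\Gamma)$. The arc-graph $A(G)$ of a graph $G$ has the arcs $(u,v)$, $uv\in E(G)$, as its vertices; two distinct arcs are adjacent if they have the same first vertex, or if they are $(u,v)$ and $(v,u)$ for some edge $uv$. For even $g$ let $N(7,g)=2\sum_{i=0}^{g/2-1}6^i$ be the Moore bound. **Proposition.** Let $G$ be a 7-regular arc-transitive graph (its automorphism group acts transitively on its arcs) of even girth $g\ge 58$ whose order $n$ satisfies $n\le 1.0005\,N$, where $N=N(7,g)$. Then there is a tree $T$ with a root $r$, of order at most $6g\sqrt{N}$, such that for every edge $uv$ of $G$ the graph $H$ that is obtained from the disjoint union of $A(G)$ and $T$ by joining $r$ to both $(u,v)$ and $(v,u)$ is connected, and the proportion of the vertices of $H$ that are Šoltés vertices is at least $$\frac57-\frac{12}{7}\Bigl(1-\frac{N}{n}\Bigr)-\frac{g}{\sqrt N},$$ and is larger than $0.7134$. (Here $5/7=0.71428\ldots$)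 -/

import Mathlib

/-- `G` is arc-transitive: its automorphism group acts transitively on ordered pairs of
adjacent vertices. -/
def IsArcTransitive {V : Type*} (G : SimpleGraph V) : Prop :=
  ∀ u v u' v' : V, G.Adj u v → G.Adj u' v' → ∃ φ : G ≃g G, φ u = u' ∧ φ v = v'

/-- The Moore bound `N(d, g)`: the classical lower bound for the order of a `d`-regular graph of girth `g`. -/
def mooreBound (d g : ℕ) : ℕ :=
  if Even g then 2 * ∑ i ∈ Finset.range (g / 2), (d - 1) ^ i
  else 1 + d * ∑ i ∈ Finset.range (g / 2), (d - 1) ^ i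

/-- The arc-graph of `G`. Its vertices are the arcs (darts) of `G`; two different arcs are adjacent
if they have the same root or are the two orientations of one edge. -/
def arcGraph {V : Type*} (G : SimpleGraph V) : SimpleGraph G.Dart where
  Adj a b := a ≠ b ∧ (a.fst = b.fst ∨ b = a.symm)
  symm := ⟨by
    rintro a b ⟨hne, h⟩
    refine ⟨hne.symm, ?_⟩
    rcases h with h | h
    · exact Or.inl h.symm
    · right
      rw [h, SimpleGraph.Dart.symm_symm]⟩
  loopless := ⟨fun a h => h.1 rfl⟩

/-- The total distance (Wiener index) of a finite graph: the sum of the distances over all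
unordered pairs of vertices. It is meaningful for connected graphs. -/
noncomputable def wienerIndex {V : Type*} [Finite V] (G : SimpleGraph V) : ℕ :=
  ∑ᶠ e : Sym2 V, Sym2.lift ⟨fun u v => G.dist u v, fun _ _ => G.dist_comm⟩ e

/-- `v` is a Šoltés vertex of the connected graph `G`: deleting `v` leaves a connected graph
with the same total distance. -/
def IsSoltesVertex {V : Type*} [Finite V] (G : SimpleGraph V) (v : V) : Prop :=
  (G.induce {v}ᶜ).Connected ∧ wienerIndex (G.induce {v}ᶜ) = wienerIndex G

/-- The proportion of the vertices of `G` that are Šoltés vertices. -/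
noncomputable def soltesFraction {V : Type*} [Finite V] (G : SimpleGraph V) : ℝ :=
  ({v : V | IsSoltesVertex G v}.ncard : ℝ) / (Nat.card V : ℝ)

/-- The disjoint union of `G` and `T` with the vertex `r` of `T` joined to the vertices
`x` and `y` of `G`. -/
def attachAt {V W : Type*} (G : SimpleGraph V) (x y : V) (T : SimpleGraph W) (r : W) :
    SimpleGraph (V ⊕ W) :=
  (G ⊕g T) ⊔ SimpleGraph.edge (Sum.inl x) (Sum.inr r) ⊔ SimpleGraph.edge (Sum.inl y) (Sum.inr r)

set_option linter.unusedSectionVars false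

/-! Put g = 2h. A walk of the arc-graph projects to a walk of `G`, and over a path π of `G` runs a
path of the arc-graph within the vertices x, y and both darts of every edge of π, the footprint
`foot x y π`. The girth forces two footprints with the same distinct ends to have at least 2g + 2
vertices together (`two_mul_girth_le_card_foot`). So a footprint with D + 1 ≤ g + 1 vertices is
geodesic, and deleting one of its D − 1 inner vertices costs at least 2g − 2D.

By arc-transitivity every deletion changes the total distance of the arc-graph by the same c, and
double counting expresses c through the gains of pairs (`exists_wienerIndex_sub_eq`). As n is close
to N, almost all darts are rooted in the ball around a given edge, where the distances are known;
this makes c positive and large (`le_sum_delGain`, `le_totalGain`).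

If deleting v keeps the distances of the other vertices to the pair a, `a.symm`, then it changes the
total distance of H by c − Σ_t (d(v) + 1 + dist(r, t)), where d(v) is the distance of v to the pair
(`isSoltesVertex_attachAt`). All inner leaves of the ball have this property with d(v) = g − 1
(`innerLeaf_spec`). A single tree with Σ_t (g + dist(r, t)) = c (`exists_tree_sum_eq`) thus makes
them all Šoltés vertices, whichever edge is chosen. They number at least 12N − 7n out of 7n + |T|,
and |T| is of order √c, which is negligible. -/

namespace Soltes

open SimpleGraph Finset

/-! ### Paths of the arc-graph and their footprints. -/

section Footprint

variable {V : Type*} [Fintype V] [DecidableEq V] {G : SimpleGraph V} [DecidableRel G.Adj]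

/-- The darts of the edges of a walk. -/
def walkDarts {u v : V} (π : G.Walk u v) : Finset G.Dart := univ.filter fun d => d.edge ∈ π.edges

/-- The vertices of the path of the arc-graph from `x` to `y` that lies over the path `π`. -/
def foot (x y : G.Dart) {u v : V} (π : G.Walk u v) : Finset G.Dart := insert x (insert y (walkDarts π))

theorem girth_le_add_length {u v : V} {π ρ : G.Walk u v} (hπ : π.IsPath) (hρ : ρ.IsPath)
    (h : π ≠ ρ) : G.girth ≤ π.length + ρ.length := by
  obtain ⟨w, -, -, c, hc, hl⟩ := hπ.exists_isCycle_length_le_add_of_ne hρ h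
  exact (girth_le_length hc).trans hl

@[simp] theorem mem_walkDarts {u v : V} {π : G.Walk u v} {d : G.Dart} :
    d ∈ walkDarts π ↔ d.edge ∈ π.edges := by simp [walkDarts]

theorem mem_foot {x y d : G.Dart} {u v : V} {π : G.Walk u v} :
    d ∈ foot x y π ↔ d = x ∨ d = y ∨ d.edge ∈ π.edges := by simp [foot]

theorem card_walkDarts {u v : V} {π : G.Walk u v} (hπ : π.IsPath) :
    (walkDarts π).card = 2 * π.length := by
  have h : ∀ d ∈ walkDarts π, d.edge ∈ π.edges.toFinset := by simp
  rw [card_eq_sum_card_fiberwise h, Finset.sum_const_nat (m := 2),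
    List.toFinset_card_of_nodup hπ.isTrail.edges_nodup, Walk.length_edges, mul_comm]
  intro e he
  rw [List.mem_toFinset] at he
  rw [← G.dart_edge_fiber_card e (π.edges_subset_edgeSet he)]
  congr 1
  ext d
  simp only [mem_filter, mem_walkDarts, mem_univ, true_and]
  exact ⟨fun h => h.2, fun h => ⟨h ▸ he, h⟩⟩

theorem card_foot {x y : G.Dart} (hxy : x ≠ y) {u v : V} {π : G.Walk u v} (hπ : π.IsPath) :
    (foot x y π).card = 2 * π.length + (if x.edge ∈ π.edges then 0 else 1)
      + (if y.edge ∈ π.edges then 0 else 1) := by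
  rw [foot, card_insert_eq_ite, card_insert_eq_ite, card_walkDarts hπ]
  simp only [mem_insert, mem_walkDarts, hxy, false_or]
  split_ifs <;> rfl

/-- Two paths that start with the same edge differ after it. -/
theorem girth_add_two_le_of_edge {x : G.Dart} {v : V} {π ρ : G.Walk x.fst v} (hπ : π.IsPath)
    (hρ : ρ.IsPath) (h : π ≠ ρ) (h1 : x.edge ∈ π.edges) (h2 : x.edge ∈ ρ.edges) :
    G.girth + 2 ≤ π.length + ρ.length := by
  -- An edge of a path at its starting vertex can only be its first edge.
  have key : ∀ {σ : G.Walk x.fst v}, σ.IsPath → x.edge ∈ σ.edges →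
      ∃ τ : G.Walk x.snd v, τ.IsPath ∧ σ = Walk.cons x.adj τ := by
    intro σ hσ hx
    have hs := hσ.eq_snd_of_mem_edges hx
    cases σ with
    | nil => simp at hx
    | cons hadj τ =>
      simp only [Walk.snd_cons] at hs
      subst hs
      exact ⟨τ, hσ.of_cons, rfl⟩
  obtain ⟨π', hπ', rfl⟩ := key hπ h1
  obtain ⟨ρ', hρ', rfl⟩ := key hρ h2
  have := girth_le_add_length hπ' hρ' (fun e => h (by rw [e]))
  simp only [Walk.length_cons]
  omega

/-- The lengths sum to at least g, which accounts for 2g. If the edge of x is missing from one path,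
then x is an extra vertex of that footprint; if both paths use it, cancelling this common first edge
raises the length bound to g + 2. The same holds at y. -/
theorem two_mul_girth_le_card_foot {x y : G.Dart} (hxy : x ≠ y) {π ρ : G.Walk x.fst y.fst}
    (hπ : π.IsPath) (hρ : ρ.IsPath) (h : π ≠ ρ) :
    2 * G.girth + 2 ≤ (foot x y π).card + (foot x y ρ).card := by
  rw [card_foot hxy hπ, card_foot hxy hρ]
  have h0 := girth_le_add_length hπ hρ h
  have h1 := girth_add_two_le_of_edge hπ hρ h
  have h2 := girth_add_two_le_of_edge (x := y) hπ.reverse hρ.reverse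
    (fun e => h (Walk.reverse_injective e))
  simp only [Walk.edges_reverse, List.mem_reverse, Walk.length_reverse] at h2
  split_ifs <;> simp_all <;> omega

/-- Every walk of the arc-graph covers the footprint of a path of `G`. -/
theorem exists_path_foot_subset {x y : G.Dart} (w : (arcGraph G).Walk x y) :
    ∃ π : G.Walk x.fst y.fst, π.IsPath ∧ foot x y π ⊆ w.support.toFinset := by
  -- Only the swaps a → `a.symm` move the root, and each swap puts both darts of its edge on the
  -- walk.
  have key : ∀ {x y : G.Dart} (w : (arcGraph G).Walk x y), ∃ π : G.Walk x.fst y.fst,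
      ∀ d : G.Dart, d.edge ∈ π.edges → d ∈ w.support := by
    intro x y w
    induction w with
    | nil => exact ⟨Walk.nil, by simp⟩
    | @cons a b c hab w ih =>
      obtain ⟨π, hπ⟩ := ih
      rcases hab.2 with h | h
      · refine ⟨π.copy h.symm rfl, fun d hd => ?_⟩
        rw [Walk.edges_copy] at hd
        exact List.mem_cons_of_mem _ (hπ d hd)
      · subst h
        refine ⟨Walk.cons (show G.Adj a.fst a.symm.fst from a.adj) π, fun d hd => ?_⟩
        rw [Walk.edges_cons, List.mem_cons] at hd
        rw [Walk.support_cons]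
        rcases hd with hd | hd
        · rcases (dart_edge_eq_iff d a).1 hd with rfl | rfl
          · simp
          · exact List.mem_cons_of_mem _ w.start_mem_support
        · exact List.mem_cons_of_mem _ (hπ d hd)
  obtain ⟨π, hπ⟩ := key w
  refine ⟨π.bypass, π.bypass_isPath, fun d hd => ?_⟩
  rw [List.mem_toFinset]
  rcases mem_foot.1 hd with rfl | rfl | h
  · exact w.start_mem_support
  · exact w.end_mem_support
  · exact hπ d (π.edges_bypass_subset_edges h)

theorem exists_path_card_foot_le {x y : G.Dart} (w : (arcGraph G).Walk x y) :
    ∃ π : G.Walk x.fst y.fst, π.IsPath ∧ (∀ d ∈ foot x y π, d ∈ w.support) ∧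
      (foot x y π).card ≤ w.length + 1 := by
  obtain ⟨π, hπ, h⟩ := exists_path_foot_subset w
  refine ⟨π, hπ, fun d hd => List.mem_toFinset.1 (h hd), (card_le_card h).trans ?_⟩
  rw [← Walk.length_support]
  exact w.support.toFinset_card_le

/-- Over every walk of `G` there is a path of the arc-graph inside its footprint. -/
theorem exists_walk_support_subset_foot {x y : G.Dart} (π : G.Walk x.fst y.fst) :
    ∃ w : (arcGraph G).Walk x y, (∀ d ∈ w.support, d ∈ foot x y π) ∧
      w.length + 1 ≤ (foot x y π).card := by
  have key : ∀ {u v : V} (π : G.Walk u v) (x y : G.Dart), x.fst = u → y.fst = v →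
      ∃ w : (arcGraph G).Walk x y, ∀ d ∈ w.support, d ∈ foot x y π := by
    intro u v π
    induction π with
    | nil =>
      intro x y hx hy
      by_cases hxy : x = y
      · subst hxy; exact ⟨Walk.nil, by simp [mem_foot]⟩
      · have hadj : (arcGraph G).Adj x y := ⟨hxy, Or.inl (hx.trans hy.symm)⟩
        exact ⟨Walk.cons hadj Walk.nil, by simp [mem_foot]⟩
    | @cons a b c hab π ih =>
      intro x y hx hy
      let z : G.Dart := ⟨(a, b), hab⟩
      obtain ⟨w, hw⟩ := ih z.symm y rfl hy
      have hz : (arcGraph G).Adj z z.symm := ⟨z.symm_ne.symm, Or.inr rfl⟩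
      have hmem : ∀ d ∈ (Walk.cons hz w).support, d ∈ foot x y (Walk.cons hab π) := by
        intro d hd
        rw [Walk.support_cons, List.mem_cons] at hd
        rw [mem_foot, Walk.edges_cons, List.mem_cons]
        rcases hd with rfl | hd
        · right; right; left; rfl
        · rcases mem_foot.1 (hw d hd) with rfl | h | h
          · right; right; left; exact z.edge_symm
          · exact Or.inr (Or.inl h)
          · exact Or.inr (Or.inr (Or.inr h))
      by_cases hxz : x = z
      · subst hxz
        exact ⟨Walk.cons hz w, hmem⟩
      · have hadj : (arcGraph G).Adj x z := ⟨hxz, Or.inl hx⟩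
        refine ⟨Walk.cons hadj (Walk.cons hz w), fun d hd => ?_⟩
        rw [Walk.support_cons, List.mem_cons] at hd
        rcases hd with rfl | hd
        · simp [mem_foot]
        · exact hmem d hd
  obtain ⟨w, hw⟩ := key π x y rfl rfl
  refine ⟨w.bypass, fun d hd => hw d (w.support_bypass_subset_support hd), ?_⟩
  rw [← Walk.length_support, ← List.toFinset_card_of_nodup w.bypass_isPath.support_nodup]
  exact card_le_card fun d hd => hw d (w.support_bypass_subset_support (List.mem_toFinset.1 hd))

end Footprint

/-! ### Distances after deleting a vertex. -/

section Deletion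

variable {α : Type*} [DecidableEq α] (Γ : SimpleGraph α)

/-- The distance of `x` and `y` in `Γ ∖ v`, and `0` if `x = v` or `y = v`. -/
noncomputable def delDist (v x y : α) : ℕ :=
  if h : x ≠ v ∧ y ≠ v then (Γ.induce {v}ᶜ).dist ⟨x, h.1⟩ ⟨y, h.2⟩ else 0

variable {Γ}

theorem delDist_left (v y : α) : delDist Γ v v y = 0 := by simp [delDist]

theorem delDist_right (v x : α) : delDist Γ v x v = 0 := by simp [delDist]

theorem delDist_self (v x : α) : delDist Γ v x x = 0 := by
  unfold delDist; split_ifs <;> simp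

theorem delDist_le_length {v x y : α} (w : Γ.Walk x y) (hw : v ∉ w.support) :
    delDist Γ v x y ≤ w.length := by
  have h : ∀ z ∈ w.support, z ∈ ({v}ᶜ : Set α) := fun z hz => by
    rintro rfl; exact hw hz
  rw [delDist, dif_pos ⟨h x w.start_mem_support, h y w.end_mem_support⟩]
  refine (dist_le (w.induce _ h)).trans (le_of_eq ?_)
  rw [← Nat.add_left_inj (n := 1), ← Walk.length_support, ← Walk.length_support,
    Walk.support_induce, List.length_attachWith]

theorem exists_walk_length_eq_delDist {v x y : α} (hc : (Γ.induce {v}ᶜ).Connected) (hx : x ≠ v)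
    (hy : y ≠ v) : ∃ w : Γ.Walk x y, v ∉ w.support ∧ w.length = delDist Γ v x y := by
  have key : ∀ {a b : ({v}ᶜ : Set α)} (w : (Γ.induce {v}ᶜ).Walk a b),
      ∃ w' : Γ.Walk a b, v ∉ w'.support ∧ w'.length = w.length := by
    intro a b w
    refine ⟨w.map (Embedding.induce _).toHom, fun h => ?_, Walk.length_map _ _⟩
    obtain ⟨z, -, hz⟩ := List.mem_map.1 ((Walk.support_map _ w) ▸ h)
    exact z.2 hz
  obtain ⟨w, hw⟩ := hc.exists_walk_length_eq_dist ⟨x, hx⟩ ⟨y, hy⟩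
  obtain ⟨w', h1, h2⟩ := key w
  refine ⟨w', h1, ?_⟩
  rw [delDist, dif_pos ⟨hx, hy⟩, h2, hw]

theorem dist_le_delDist {v x y : α} (hc : (Γ.induce {v}ᶜ).Connected) (hx : x ≠ v)
    (hy : y ≠ v) : Γ.dist x y ≤ delDist Γ v x y := by
  obtain ⟨w, -, hw⟩ := exists_walk_length_eq_delDist hc hx hy
  exact hw ▸ dist_le w

theorem delDist_triangle {v x y z : α} (hc : (Γ.induce {v}ᶜ).Connected) (hx : x ≠ v)
    (hy : y ≠ v) (hz : z ≠ v) : delDist Γ v x z ≤ delDist Γ v x y + delDist Γ v y z := by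
  rw [delDist, dif_pos ⟨hx, hz⟩, delDist, dif_pos ⟨hx, hy⟩, delDist, dif_pos ⟨hy, hz⟩]
  exact hc.dist_triangle

/-- If the neighbours of `v` stay as close to `S` as `v` is, then deleting `v` does not
increase the distances to `S`. -/
theorem exists_delDist_le_dist (hΓ : Γ.Connected) {v : α} {S : Set α} (hv : v ∉ S)
    (hc : (Γ.induce {v}ᶜ).Connected)
    {D : ℕ} (hD : ∀ s ∈ S, D ≤ Γ.dist v s)
    (hnb : ∀ u, Γ.Adj u v → ∃ s ∈ S, delDist Γ v u s ≤ D) {z : α} (hz : z ≠ v) :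
    ∀ s ∈ S, ∃ t ∈ S, delDist Γ v z t ≤ Γ.dist z s := by
  intro s hs
  obtain ⟨w, hw⟩ := hΓ.exists_walk_length_eq_dist z s
  by_cases hvw : v ∈ w.support
  · have h1 := congrArg Walk.length (w.take_spec hvw)
    rw [Walk.length_append, hw] at h1
    have h2 := dist_le (w.dropUntil v hvw)
    have h3 := hD s hs
    -- After bypassing, v occurs only at the end, so the part up to the preceding vertex u avoids v.
    -- The rest of `w` from v has length at least `D`, and going from u to `S` instead costs at most
    -- `D`.
    have hp := ((w.takeUntil v hvw).length_bypass_le_length)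
    have hP := (w.takeUntil v hvw).bypass_isPath
    set P := (w.takeUntil v hvw).bypass
    obtain ⟨u, q, hadj, hq⟩ : ∃ (u : α) (q : Γ.Walk z u) (h : Γ.Adj u v), P = q.concat h := by
      cases P with
      | nil => exact absurd rfl hz
      | cons h p => obtain ⟨u, q, h', e⟩ := Walk.exists_cons_eq_concat h p; exact ⟨u, q, h', e⟩
    obtain ⟨t, ht, hut⟩ := hnb u hadj
    refine ⟨t, ht, ?_⟩
    rw [hq] at hP hp
    rw [Walk.concat_isPath_iff] at hP
    rw [Walk.length_concat] at hp
    have h4 := delDist_le_length q hP.2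
    have h5 := delDist_triangle hc hz hadj.ne (fun e => hv (e ▸ ht) : t ≠ v)
    omega
  · exact ⟨s, hs, (delDist_le_length w hvw).trans hw.le⟩

end Deletion

/-! ### Distances, detours and gains in the arc-graph. -/

section Distances

variable {V : Type*} [Fintype V] [DecidableEq V] {G : SimpleGraph V} [DecidableRel G.Adj]

theorem dist_add_one_le_card_foot {x y : G.Dart} (π : G.Walk x.fst y.fst) :
    (arcGraph G).dist x y + 1 ≤ (foot x y π).card := by
  obtain ⟨w, -, hw⟩ := exists_walk_support_subset_foot π
  exact (Nat.succ_le_succ (dist_le w)).trans hw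

theorem delDist_add_one_le_card_foot {v x y : G.Dart} (π : G.Walk x.fst y.fst)
    (hv : v ∉ foot x y π) : delDist (arcGraph G) v x y + 1 ≤ (foot x y π).card := by
  obtain ⟨w, hw', hw⟩ := exists_walk_support_subset_foot π
  exact (Nat.succ_le_succ (delDist_le_length w fun h => hv (hw' _ h))).trans hw

theorem arcGraph_connected (hG : G.Connected) [Nonempty G.Dart] : (arcGraph G).Connected where
  preconnected x y := by
    obtain ⟨π⟩ := hG.preconnected x.fst y.fst
    exact ⟨(exists_walk_support_subset_foot π).choose⟩

theorem exists_path_card_foot_eq (hG : G.Connected) (x y : G.Dart) :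
    ∃ π : G.Walk x.fst y.fst, π.IsPath ∧ (foot x y π).card = (arcGraph G).dist x y + 1 := by
  have : Nonempty G.Dart := ⟨x⟩
  obtain ⟨w, hw⟩ := (arcGraph_connected hG).exists_walk_length_eq_dist x y
  obtain ⟨π, hπ, -, h⟩ := exists_path_card_foot_le w
  exact ⟨π, hπ, le_antisymm (hw ▸ h) (dist_add_one_le_card_foot π)⟩

/-- Any other path has a footprint of at least 2g + 2 − (D + 1) ≥ D + 1 vertices. -/
theorem dist_eq_of_card_foot (hG : G.Connected) {x y : G.Dart} {π : G.Walk x.fst y.fst}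
    (hπ : π.IsPath) {D : ℕ} (hD : (foot x y π).card = D + 1) (hle : D ≤ G.girth) :
    (arcGraph G).dist x y = D := by
  have h1 := dist_add_one_le_card_foot π
  obtain ⟨ρ, hρ, h⟩ := exists_path_card_foot_eq hG x y
  by_cases hxy : x = y
  · subst hxy
    have : π = Walk.nil := (Walk.isPath_iff_nil.1 hπ).eq_nil
    subst this
    simp [foot, walkDarts] at hD
    simp; omega
  · by_cases e : π = ρ
    · subst e; omega
    · have := two_mul_girth_le_card_foot hxy hπ hρ e
      omega

/-- A walk avoiding v covers the footprint of a path other than π. -/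
theorem le_delDist_of_mem_foot {x y v : G.Dart} {π : G.Walk x.fst y.fst}
    (hπ : π.IsPath) {D : ℕ} (hD : (foot x y π).card = D + 1)
    (hx : x ≠ v) (hy : y ≠ v) (hxy : x ≠ y) (hv : v ∈ foot x y π)
    (hc : ((arcGraph G).induce {v}ᶜ).Connected) :
    2 * G.girth ≤ delDist (arcGraph G) v x y + D := by
  obtain ⟨w, hw, hl⟩ := exists_walk_length_eq_delDist hc hx hy
  obtain ⟨ρ, hρ, hs, hρc⟩ := exists_path_card_foot_le w
  have hne : π ≠ ρ := by
    rintro rfl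
    exact hw (hs v hv)
  have := two_mul_girth_le_card_foot hxy hπ hρ hne
  omega

/-- Every edge of `G` lies on a closed walk of length `g` that uses it once. -/
def HasDetours (G : SimpleGraph V) (g : ℕ) : Prop :=
  ∀ d : G.Dart, ∃ ρ : G.Walk d.fst d.snd, ρ.length + 1 = g ∧ d.edge ∉ ρ.edges

theorem IsArcTransitive.hasDetours (hG : IsArcTransitive G) (hg : G.girth ≠ 0) :
    HasDetours G G.girth := by
  intro d
  obtain ⟨a, w, hw, hl⟩ := exists_girth_eq_length.2 (mt girth_eq_zero.2 hg)
  cases w with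
  | nil => simp at hw
  | @cons _ b _ hab p =>
    rw [Walk.cons_isCycle_iff] at hw
    -- The shortest cycle without its edge ab is a walk from b to a; carrying the arc (b, a) to `d`
    -- makes it a detour around `d`.
    obtain ⟨φ, h1, h2⟩ := hG b a d.fst d.snd hab.symm d.adj
    refine ⟨(p.map φ.toHom).copy h1 h2, ?_, ?_⟩
    · rw [Walk.length_copy, Walk.length_map, hl, Walk.length_cons]
    · rw [Walk.edges_copy, Walk.edges_map]
      intro h
      obtain ⟨e, he, hed⟩ := List.mem_map.1 h
      have : e = s(a, b) := by
        apply Sym2.map.injective φ.injective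
        refine hed.trans ?_
        rw [Sym2.map_mk, Dart.edge, ← h1, ← h2, Sym2.eq_swap]
      exact hw.2 (this ▸ he)

/-- A path uses the edge of `v` at most once, and replacing that edge by its detour adds g − 2 to
the length. The maximum accounts for truncated subtraction. -/
theorem HasDetours.exists_path {g : ℕ} (hd : HasDetours G g) (v : G.Dart) {a b : V}
    {π : G.Walk a b} (hπ : π.IsPath) :
    ∃ ρ : G.Walk a b, ρ.IsPath ∧ v.edge ∉ ρ.edges ∧ ρ.length + 2 ≤ π.length + max g 2 := by
  have key : ∀ {a b : V} (π : G.Walk a b), ∃ ρ : G.Walk a b, v.edge ∉ ρ.edges ∧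
      ρ.length ≤ π.length + (g - 2) * π.edges.count v.edge := by
    intro a b π
    induction π with
    | nil => exact ⟨Walk.nil, by simp⟩
    | @cons a b c hab π ih =>
      obtain ⟨ρ, h1, h2⟩ := ih
      by_cases he : s(a, b) = v.edge
      · obtain ⟨τ, h3, h4⟩ := hd ⟨(a, b), hab⟩
        refine ⟨τ.append ρ, ?_, ?_⟩
        · rw [Walk.edges_append, List.mem_append]
          rintro (h | h)
          · exact h4 (by rw [← he] at h; exact h)
          · exact h1 h
        · rw [Walk.length_append, Walk.edges_cons, he, List.count_cons_self, Walk.length_cons,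
            mul_add, mul_one]
          omega
      · refine ⟨Walk.cons hab ρ, ?_, ?_⟩
        · rw [Walk.edges_cons, List.mem_cons]
          rintro (h | h)
          · exact he h.symm
          · exact h1 h
        · rw [Walk.length_cons, Walk.edges_cons, List.count_cons_of_ne he, Walk.length_cons]
          omega
  obtain ⟨ρ, h1, h2⟩ := key π
  refine ⟨ρ.bypass, ρ.bypass_isPath, fun h => h1 (ρ.edges_bypass_subset_edges h), ?_⟩
  have h3 := ρ.length_bypass_le_length
  have h4 := hπ.isTrail.count_edges_le_one v.edge
  have h5 := Nat.mul_le_mul_left (g - 2) h4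
  omega

theorem notMem_foot {x y v : G.Dart} {a b : V} {π : G.Walk a b} (hx : x ≠ v) (hy : y ≠ v)
    (h : v.edge ∉ π.edges) : v ∉ foot x y π := by
  rw [mem_foot]
  rintro (h' | h' | h')
  exacts [hx h'.symm, hy h'.symm, h h']

theorem HasDetours.connected_induce_compl {g : ℕ} (hd : HasDetours G g) (hG : G.Connected)
    (v : G.Dart) : ((arcGraph G).induce {v}ᶜ).Connected where
  preconnected := by
    rintro ⟨x, hx⟩ ⟨y, hy⟩
    obtain ⟨π, hπ⟩ := hG.preconnected.exists_isPath x.fst y.fst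
    obtain ⟨ρ, -, h, -⟩ := hd.exists_path v hπ
    obtain ⟨w, hw, -⟩ := exists_walk_support_subset_foot ρ
    refine ⟨w.induce _ fun z hz => ?_⟩
    rintro rfl
    exact notMem_foot hx hy h (hw _ hz)
  nonempty := ⟨⟨v.symm, v.symm_ne⟩⟩

theorem HasDetours.delDist_le {g : ℕ} (hd : HasDetours G g) (hg : 2 ≤ g) {v x y : G.Dart}
    {π : G.Walk x.fst y.fst} (hπ : π.IsPath) (hx : x ≠ v) (hy : y ≠ v) (hxy : x ≠ y) :
    delDist (arcGraph G) v x y + 3 ≤ (foot x y π).card + 2 * g := by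
  obtain ⟨ρ, hρ, h, hl⟩ := hd.exists_path v hπ
  have h1 := delDist_add_one_le_card_foot ρ (notMem_foot hx hy h)
  rw [card_foot hxy hρ] at h1
  rw [card_foot hxy hπ]
  rw [max_eq_left hg] at hl
  split_ifs at h1 ⊢ <;> omega

/-- The total change of the distance of `x` and `y` over all deletions of a vertex of the
arc-graph. -/
noncomputable def delGain (x y : G.Dart) : ℤ :=
  ∑ v, ((delDist (arcGraph G) v x y : ℤ) - (arcGraph G).dist x y)

theorem delGain_self (x : G.Dart) : delGain x x = 0 := by
  simp [delGain, delDist_self]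

/-- The deletions of x and of y each contribute minus the distance, as `delDist` is 0 there. -/
theorem delGain_eq {x y : G.Dart} (hxy : x ≠ y) :
    delGain x y = -2 * ((arcGraph G).dist x y : ℤ) + ∑ v ∈ univ \ {x, y},
      ((delDist (arcGraph G) v x y : ℤ) - (arcGraph G).dist x y) := by
  rw [delGain, ← Finset.sum_sdiff (subset_univ {x, y}), Finset.sum_pair hxy, delDist_left,
    delDist_right]
  push_cast
  ring

theorem neg_two_mul_dist_le_delGain (hc : ∀ v, ((arcGraph G).induce {v}ᶜ).Connected)
    (x y : G.Dart) : -2 * ((arcGraph G).dist x y : ℤ) ≤ delGain x y := by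
  by_cases hxy : x = y
  · subst hxy; simp [delGain_self]
  · rw [delGain_eq hxy]
    refine le_add_of_nonneg_right (Finset.sum_nonneg fun v hv => ?_)
    simp only [mem_sdiff, mem_univ, true_and, mem_insert, mem_singleton, not_or] at hv
    have := dist_le_delDist (hc v) (Ne.symm hv.1) (Ne.symm hv.2)
    omega

/-- Each of the D − 1 inner vertices of the footprint gains at least 2g − 2D, no other deletion
shortens the distance, and the two ends lose 2D. -/
theorem le_delGain_of_card_foot (hG : G.Connected) (hc : ∀ v, ((arcGraph G).induce {v}ᶜ).Connected)
    {x y : G.Dart} {π : G.Walk x.fst y.fst} (hπ : π.IsPath) {D : ℕ}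
    (hD : (foot x y π).card = D + 1) (hle : D ≤ G.girth) :
    ((D : ℤ) - 1) * (2 * G.girth - 2 * D) - 2 * D ≤ delGain x y := by
  have hdist := dist_eq_of_card_foot hG hπ hD hle
  by_cases hxy : x = y
  · subst hxy
    rw [SimpleGraph.dist_self] at hdist
    subst hdist
    rw [delGain_self]
    push_cast
    linarith
  · rw [delGain_eq hxy, hdist]
    have hsub : foot x y π \ {x, y} ⊆ univ \ {x, y} := Finset.sdiff_subset_sdiff (subset_univ _) le_rfl
    have hcard : (foot x y π \ {x, y}).card + 2 = D + 1 := by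
      rw [← hD, ← Finset.card_pair hxy]
      exact Finset.card_sdiff_add_card_eq_card (by simp [insert_subset_iff, mem_foot])
    have h1 : ∑ v ∈ foot x y π \ {x, y}, ((2 : ℤ) * G.girth - 2 * D) ≤
        ∑ v ∈ foot x y π \ {x, y}, ((delDist (arcGraph G) v x y : ℤ) - D) := by
      refine Finset.sum_le_sum fun v hv => ?_
      simp only [mem_sdiff, mem_insert, mem_singleton, not_or] at hv
      have := le_delDist_of_mem_foot hπ hD (Ne.symm hv.2.1) (Ne.symm hv.2.2) hxy hv.1 (hc v)
      omega
    have h2 : ∑ v ∈ foot x y π \ {x, y}, ((delDist (arcGraph G) v x y : ℤ) - D) ≤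
        ∑ v ∈ univ \ {x, y}, ((delDist (arcGraph G) v x y : ℤ) - D) := by
      refine Finset.sum_le_sum_of_subset_of_nonneg hsub fun v hv _ => ?_
      simp only [mem_sdiff, mem_univ, true_and, mem_insert, mem_singleton, not_or] at hv
      have := dist_le_delDist (hc v) (Ne.symm hv.1) (Ne.symm hv.2)
      omega
    rw [Finset.sum_const, nsmul_eq_mul] at h1
    have h3 : ((foot x y π \ {x, y}).card : ℤ) = D - 1 := by omega
    rw [h3] at h1
    linarith

/-- Only vertices of one fixed geodesic footprint can contribute positively, and a detour costs at
most 2g − 2. -/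
theorem HasDetours.delGain_le {g : ℕ} (hd : HasDetours G g) (hG : G.Connected) (hg : 2 ≤ g)
    (x y : G.Dart) : delGain x y ≤ ((arcGraph G).dist x y + 1) * (2 * g - 2) := by
  have hg' : (0 : ℤ) ≤ 2 * g - 2 := by omega
  by_cases hxy : x = y
  · subst hxy; rw [delGain_self]; positivity
  · obtain ⟨π, hπ, hcard⟩ := exists_path_card_foot_eq hG x y
    have : ∀ v : G.Dart, ((delDist (arcGraph G) v x y : ℤ) - (arcGraph G).dist x y) ≤
        if v ∈ foot x y π then 2 * (g : ℤ) - 2 else 0 := by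
      intro v
      by_cases hv : v ∈ foot x y π
      · rw [if_pos hv]
        by_cases h : x ≠ v ∧ y ≠ v
        · have := hd.delDist_le hg hπ h.1 h.2 hxy
          omega
        · rw [delDist, dif_neg h]
          omega
      · rw [if_neg hv]
        have := delDist_add_one_le_card_foot π hv
        omega
    refine (Finset.sum_le_sum fun v _ => this v).trans ?_
    rw [Finset.sum_ite_mem, univ_inter, Finset.sum_const, nsmul_eq_mul, hcard]
    push_cast
    exact le_rfl

end Distances

/-! ### The tree that hangs off an arc below the girth. -/

section Branches

variable {V : Type*} [Fintype V] [DecidableEq V] {G : SimpleGraph V} [DecidableRel G.Adj]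

/-- The darts with the same first vertex as `z` other than `z`. -/
def siblings (z : G.Dart) : Finset G.Dart := univ.filter fun d => d.fst = z.fst ∧ d ≠ z

/-- The last darts, reversed, of the walks of length `k` from `x.fst` that do not backtrack and do
not start with `x`. -/
def branch : ℕ → G.Dart → Finset G.Dart
  | 0, x => {x}
  | k + 1, x => ((branch k x).biUnion siblings).image Dart.symm

theorem mem_siblings {z d : G.Dart} : d ∈ siblings z ↔ d.fst = z.fst ∧ d ≠ z := by simp [siblings]

theorem mem_branch_succ {k : ℕ} {x y : G.Dart} :
    y ∈ branch (k + 1) x ↔ ∃ z ∈ branch k x, y.snd = z.fst ∧ y.symm ≠ z := by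
  simp only [branch, mem_image, mem_biUnion, mem_siblings]
  constructor
  · rintro ⟨d, ⟨z, hz, h1, h2⟩, rfl⟩
    exact ⟨z, hz, h1, by rwa [Dart.symm_symm]⟩
  · rintro ⟨z, hz, h1, h2⟩
    exact ⟨y.symm, ⟨z, hz, h1, h2⟩, y.symm_symm⟩

theorem length_pos_of_mem_edges {a b : V} {π : G.Walk a b} {e : Sym2 V} (h : e ∈ π.edges) :
    0 < π.length := by
  rw [← π.length_edges]
  exact List.length_pos_of_mem h

theorem edge_mem_edges_of_mem_support {a b c : V} {π : G.Walk a b} (hπ : π.IsPath)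
    (hadj : G.Adj a c) (hc : c ∈ π.support) (hl : π.length + 1 < G.girth) :
    s(a, c) ∈ π.edges := by
  by_contra hn
  have h1 : hadj.toWalk ≠ π.takeUntil c hc := by
    intro e
    apply hn
    apply π.edges_takeUntil_subset_edges hc
    rw [← e]
    simp
  have h2 := girth_le_add_length hadj.isPath_toWalk (hπ.takeUntil hc) h1
  have h3 := π.length_takeUntil_le_length hc
  have h4 : hadj.toWalk.length = 1 := rfl
  omega

/-- A dart of the branch points back towards x. If the next vertex were already on the path, the
girth would force it to be the second vertex of the path, and this backtracking is excluded by
`siblings`. -/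
theorem exists_path_of_mem_branch {k : ℕ} {x y : G.Dart} (hk : k < G.girth)
    (hy : y ∈ branch k x) : ∃ π : G.Walk y.fst x.fst, π.IsPath ∧ π.length = k ∧
      x.edge ∉ π.edges ∧ (y = x ∧ k = 0 ∨ y.edge ∈ π.edges) := by
  induction k generalizing y with
  | zero =>
    obtain rfl := mem_singleton.1 hy
    exact ⟨Walk.nil, by simp⟩
  | succ k ih =>
    obtain ⟨z, hz, h1, h2⟩ := mem_branch_succ.1 hy
    obtain ⟨π, hπ, hl, hx, hzx⟩ := ih (by omega) hz
    have hadj : G.Adj z.fst y.fst := h1 ▸ y.adj.symm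
    have hy' : y.fst ∉ π.support := by
      intro h
      have h3 := edge_mem_edges_of_mem_support hπ hadj h (by omega)
      rcases hzx with ⟨rfl, rfl⟩ | hzx
      · cases π with
        | nil => simp at h3
        | cons h p => simp at hl
      · have h4 := hπ.eq_snd_of_mem_edges h3
        have h5 := hπ.eq_snd_of_mem_edges hzx
        apply h2
        ext
        · exact h1
        · exact h4.trans h5.symm
    refine ⟨Walk.cons hadj.symm π, hπ.cons hy', by simp [hl], ?_, Or.inr ?_⟩
    · rw [Walk.edges_cons, List.mem_cons, not_or]
      refine ⟨fun e => ?_, hx⟩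
      rw [Dart.edge, Sym2.eq_iff] at e
      rcases e with ⟨e1, e2⟩ | ⟨e1, e2⟩
      · exact hy' (e1 ▸ π.end_mem_support)
      · rcases hzx with ⟨rfl, rfl⟩ | hzx
        · apply h2
          ext
          · exact h1
          · exact e2.symm
        · have : ∀ {a : V} {π : G.Walk a x.fst}, π.IsPath → z.edge ∈ π.edges → a ≠ x.fst := by
            rintro _ π hπ h rfl
            rw [(Walk.isPath_iff_nil.1 hπ).eq_nil] at h
            simp at h
          exact this hπ hzx e1.symm
    · rw [Walk.edges_cons, List.mem_cons]
      left
      rw [Dart.edge, h1]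

/-- Branches that meet in a vertex agree. -/
theorem eq_of_mem_branch {k l : ℕ} {x y z : G.Dart} (hkl : k + l < G.girth) (hy : y ∈ branch k x)
    (hz : z ∈ branch l x) (h : y.fst = z.fst) : k = l ∧ y = z := by
  obtain ⟨π, hπ, hπl, -, h1⟩ := exists_path_of_mem_branch (by omega) hy
  obtain ⟨ρ, hρ, hρl, -, h2⟩ := exists_path_of_mem_branch (by omega) hz
  have e : π = ρ.copy h.symm rfl := by
    by_contra hne
    have := girth_le_add_length hπ ((Walk.isPath_copy _ _ _).2 hρ) hne
    rw [Walk.length_copy] at this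
    omega
  have hl : k = l := by rw [← hπl, ← hρl, e, Walk.length_copy]
  refine ⟨hl, ?_⟩
  rcases h1 with ⟨rfl, rfl⟩ | h1 <;> rcases h2 with ⟨rfl, rfl⟩ | h2
  · rfl
  · have := length_pos_of_mem_edges h2
    omega
  · have := length_pos_of_mem_edges h1
    omega
  · rw [e, Walk.edges_copy] at h1
    have h3 : z.edge ∈ (ρ.copy h.symm rfl).edges := by rwa [Walk.edges_copy]
    have h1' : s(y.fst, y.snd) ∈ (ρ.copy h.symm rfl).edges := by rwa [Walk.edges_copy]
    have h3' : s(y.fst, z.snd) ∈ (ρ.copy h.symm rfl).edges := by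
      have : s(y.fst, z.snd) = z.edge := by rw [h]; rfl
      rwa [this]
    have hp := (Walk.isPath_copy ρ h.symm rfl).2 hρ
    ext
    · exact h
    · exact (hp.eq_snd_of_mem_edges h1').trans (hp.eq_snd_of_mem_edges h3').symm

/-- The branches at the two ends of an edge are disjoint. -/
theorem fst_ne_of_mem_branch_symm {k l : ℕ} {x y z : G.Dart} (hkl : k + l + 1 < G.girth)
    (hy : y ∈ branch k x) (hz : z ∈ branch l x.symm) : y.fst ≠ z.fst := by
  intro h
  obtain ⟨π, hπ, hπl, h1, -⟩ := exists_path_of_mem_branch (by omega) hy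
  obtain ⟨ρ, hρ, hρl, h2, -⟩ := exists_path_of_mem_branch (by omega) hz
  have hq : x.snd ∉ π.support := by
    intro hq
    apply h1
    have := edge_mem_edges_of_mem_support hπ.reverse x.adj (by simpa using hq)
      (by rw [Walk.length_reverse]; omega)
    rwa [Walk.edges_reverse, List.mem_reverse] at this
  have hadj : G.Adj x.fst x.symm.fst := x.adj
  have hne : π.concat hadj ≠ ρ.copy h.symm rfl := by
    intro e
    apply h2
    have : x.edge ∈ (π.concat hadj).edges := by
      rw [Walk.edges_concat]; simp [Dart.edge]
    rw [e, Walk.edges_copy] at this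
    rwa [Dart.edge_symm]
  have hq' : x.symm.fst ∉ π.support := hq
  have hp : (π.concat hadj).IsPath := hπ.concat hq' hadj
  have := girth_le_add_length hp ((Walk.isPath_copy _ _ _).2 hρ) hne
  rw [Walk.length_copy, Walk.length_concat] at this
  omega

/-- The distances of the darts at a vertex of a branch of `x` to `x` and to `x.symm`. -/
theorem exists_paths_of_mem_branch {k : ℕ} {x y z : G.Dart} (hk : k + 1 < G.girth)
    (hz : z ∈ branch k x) (hy : y.fst = z.fst) {e : ℕ}
    (he : e = 2 * k + if y = z then 0 else 1) :
    (∃ π : G.Walk y.fst x.fst, π.IsPath ∧ (foot y x π).card = e + 1 ∧ π.length = k ∧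
      (y.edge ∈ π.edges → y = z)) ∧
    ∃ π : G.Walk y.fst x.symm.fst, π.IsPath ∧ (foot y x.symm π).card = e + 2 := by
  obtain ⟨π₀, hπ₀, hl₀, hx₀, hzx₀⟩ := exists_path_of_mem_branch (by omega) hz
  obtain ⟨π, hπ, hl, hx, hzx⟩ : ∃ π : G.Walk y.fst x.fst, π.IsPath ∧ π.length = k ∧
      x.edge ∉ π.edges ∧ (z = x ∧ k = 0 ∨ z.edge ∈ π.edges) :=
    ⟨π₀.copy hy.symm rfl, (Walk.isPath_copy _ _ _).2 hπ₀, by simpa using hl₀, by simpa using hx₀,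
      by simpa using hzx₀⟩
  have hyz : y.edge ∈ π.edges → y = z := by
    intro h
    rcases hzx with ⟨-, rfl⟩ | hzx
    · have := length_pos_of_mem_edges h
      omega
    · have h2 : s(y.fst, z.snd) ∈ π.edges := by
        have : s(y.fst, z.snd) = z.edge := by rw [hy]; rfl
        rwa [this]
      ext
      · exact hy
      · exact (hπ.eq_snd_of_mem_edges h).trans (hπ.eq_snd_of_mem_edges h2).symm
  have hq : x.snd ∉ π.support := by
    intro hq
    apply hx
    have := edge_mem_edges_of_mem_support hπ.reverse x.adj (by simpa using hq)
      (by rw [Walk.length_reverse]; omega)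
    rwa [Walk.edges_reverse, List.mem_reverse] at this
  constructor
  · refine ⟨π, hπ, ?_, hl, hyz⟩
    by_cases hyx : y = x
    · subst hyx
      have h0 : π = Walk.nil := (Walk.isPath_iff_nil.1 hπ).eq_nil
      subst h0
      have hk0 : k = 0 := by simpa using hl.symm
      subst hk0
      have : y = z := by
        rcases hzx with ⟨h, -⟩ | h
        · exact h.symm
        · simp at h
      simp [he, this, foot, walkDarts]
    · rw [card_foot hyx hπ, hl, if_neg hx, he]
      by_cases h : y = z
      · subst h
        rcases hzx with ⟨h, -⟩ | h
        · exact absurd h hyx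
        · rw [if_pos h, if_pos rfl]
      · rw [if_neg (mt hyz h), if_neg h]
  · have hyx : y ≠ x.symm := by
      rintro rfl
      exact hq π.start_mem_support
    have hadj : G.Adj x.fst x.symm.fst := x.adj
    have hq' : x.symm.fst ∉ π.support := hq
    have hp : (π.concat hadj).IsPath := hπ.concat hq' hadj
    refine ⟨π.concat hadj, hp, ?_⟩
    rw [card_foot hyx hp, Walk.length_concat, hl, he]
    have h1 : x.symm.edge ∈ (π.concat hadj).edges := by
      rw [Walk.edges_concat, Dart.edge_symm]; simp [Dart.edge]
    rw [if_pos h1]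
    by_cases h : y = z
    · have : y.edge ∈ (π.concat hadj).edges := by
        rw [Walk.edges_concat, List.concat_eq_append, List.mem_append]
        rcases hzx with ⟨h', -⟩ | h'
        · right; rw [h, h']; simp [Dart.edge]
        · left; rwa [congrArg Dart.edge h]
      rw [if_pos this, if_pos h]
      ring
    · have : y.edge ∉ (π.concat hadj).edges := by
        rw [Walk.edges_concat, List.concat_eq_append, List.mem_append, List.mem_singleton]
        rintro (h' | h')
        · exact h (hyz h')
        · rw [Dart.edge, Sym2.eq_iff] at h'
          rcases h' with ⟨e1, e2⟩ | ⟨e1, e2⟩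
          · apply h
            have hyx' : y = x := by
              ext
              · exact e1
              · exact e2
            rcases hzx with ⟨h', -⟩ | h'
            · rw [h', hyx']
            · exfalso
              have : ∀ {a : V} {π : G.Walk a x.fst}, π.IsPath → z.edge ∈ π.edges → a ≠ x.fst := by
                rintro _ π hπ h rfl
                rw [(Walk.isPath_iff_nil.1 hπ).eq_nil] at h
                simp at h
              exact this hπ h' e1
          · exact hq' (by rw [← e1]; exact π.start_mem_support)
      rw [if_neg this, if_neg h]
      ring

theorem card_filter_fst_eq (hreg : G.IsRegularOfDegree 7) (v : V) :
    (univ.filter fun d : G.Dart => d.fst = v).card = 7 := by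
  rw [G.dart_fst_fiber_card_eq_degree v]
  exact hreg v

theorem card_siblings (hreg : G.IsRegularOfDegree 7) (z : G.Dart) : (siblings z).card = 6 := by
  have h : siblings z = (univ.filter fun d : G.Dart => d.fst = z.fst).erase z := by
    ext d; simp [siblings, and_comm]
  rw [h, card_erase_of_mem (by simp), card_filter_fst_eq hreg]

theorem card_branch (hreg : G.IsRegularOfDegree 7) (x : G.Dart) {k : ℕ} (hk : 2 * k < G.girth + 2) :
    (branch k x).card = 6 ^ k := by
  induction k with
  | zero => simp [branch]
  | succ k ih =>
    rw [branch, card_image_of_injective _ Dart.symm_involutive.injective, card_biUnion]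
    · rw [Finset.sum_const_nat (fun z _ => card_siblings hreg z), ih (by omega), pow_succ]
    · intro a ha b hb hab
      refine Finset.disjoint_left.2 fun d hda hdb => ?_
      rw [mem_siblings] at hda hdb
      exact hab (eq_of_mem_branch (by omega) ha hb (hda.1.symm.trans hdb.1)).2

end Branches

/-! ### The ball around an edge and the lower bound for the gains. -/

section Trees

variable {V : Type*} [Fintype V] [DecidableEq V] {G : SimpleGraph V} [DecidableRel G.Adj]

/-- The branches of `x` up to depth `h - 1`. -/
def halfTree (h : ℕ) (x : G.Dart) : Finset G.Dart := (range h).biUnion fun k => branch k x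

/-- One dart at each vertex of the ball of radius `h - 1` around the edge of `x`. -/
def tree (h : ℕ) (x : G.Dart) : Finset G.Dart := halfTree h x ∪ halfTree h x.symm

theorem mem_halfTree {h : ℕ} {x z : G.Dart} : z ∈ halfTree h x ↔ ∃ k < h, z ∈ branch k x := by
  simp [halfTree]

theorem mem_tree {h : ℕ} {x z : G.Dart} :
    z ∈ tree h x ↔ z ∈ halfTree h x ∨ z ∈ halfTree h x.symm := by
  simp [tree]

variable {h : ℕ}

theorem disjoint_halfTree (hh : G.girth = 2 * h) (x : G.Dart) :
    Disjoint (halfTree h x) (halfTree h x.symm) := by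
  rw [Finset.disjoint_left]
  intro z h1 h2
  obtain ⟨k, hk, hz⟩ := mem_halfTree.1 h1
  obtain ⟨l, hl, hz'⟩ := mem_halfTree.1 h2
  exact fst_ne_of_mem_branch_symm (by omega) hz hz' rfl

theorem sum_halfTree (hh : G.girth = 2 * h) (x : G.Dart) {M : Type*} [AddCommMonoid M]
    (F : G.Dart → M) : ∑ z ∈ halfTree h x, F z = ∑ k ∈ range h, ∑ z ∈ branch k x, F z := by
  rw [halfTree, Finset.sum_biUnion]
  intro k hk l hl hkl
  have hk' := mem_range.1 hk
  have hl' := mem_range.1 hl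
  refine Finset.disjoint_left.2 fun z h1 h2 => hkl ?_
  exact (eq_of_mem_branch (by omega) h1 h2 rfl).1

theorem sum_tree (hh : G.girth = 2 * h) (x : G.Dart) {M : Type*} [AddCommMonoid M]
    (F : G.Dart → M) : ∑ z ∈ tree h x, F z = ∑ k ∈ range h, (∑ z ∈ branch k x, F z
      + ∑ z ∈ branch k x.symm, F z) := by
  rw [tree, Finset.sum_union (disjoint_halfTree hh x), sum_halfTree hh, sum_halfTree hh,
    Finset.sum_add_distrib]

theorem fst_injOn_tree (hh : G.girth = 2 * h) (x : G.Dart) :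
    Set.InjOn (fun z : G.Dart => z.fst) (tree h x) := by
  intro y hy z hz hyz
  simp only at hyz
  rw [mem_coe, mem_tree, mem_halfTree, mem_halfTree] at hy hz
  rcases hy with ⟨k, hk, hy⟩ | ⟨k, hk, hy⟩ <;> rcases hz with ⟨l, hl, hz⟩ | ⟨l, hl, hz⟩
  · exact (eq_of_mem_branch (by omega) hy hz hyz).2
  · exact absurd hyz (fst_ne_of_mem_branch_symm (by omega) hy hz)
  · exact absurd hyz.symm (fst_ne_of_mem_branch_symm (by omega) hz hy)
  · exact (eq_of_mem_branch (by omega) hy hz hyz).2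

theorem mooreBound_eq (hh : G.girth = 2 * h) :
    mooreBound 7 G.girth = 2 * ∑ k ∈ range h, 6 ^ k := by
  rw [mooreBound, if_pos ⟨h, by omega⟩, hh, Nat.mul_div_cancel_left _ two_pos]

theorem card_tree (hh : G.girth = 2 * h) (hreg : G.IsRegularOfDegree 7) (x : G.Dart) :
    (tree h x).card = mooreBound 7 G.girth := by
  rw [mooreBound_eq hh, card_eq_sum_ones, sum_tree hh, Finset.mul_sum]
  refine Finset.sum_congr rfl fun k hk => ?_
  rw [mem_range] at hk
  rw [← card_eq_sum_ones, ← card_eq_sum_ones, card_branch hreg x (by omega),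
    card_branch hreg x.symm (by omega)]
  ring

/-- The vertices of the ball around the edge of `x`. -/
def ballVerts (h : ℕ) (x : G.Dart) : Finset V := (tree h x).image fun z => z.fst

theorem card_ballVerts (hh : G.girth = 2 * h) (hreg : G.IsRegularOfDegree 7) (x : G.Dart) :
    (ballVerts h x).card = mooreBound 7 G.girth := by
  rw [ballVerts, card_image_of_injOn (fst_injOn_tree hh x), card_tree hh hreg]

theorem mooreBound_le_card (hh : G.girth = 2 * h) (hreg : G.IsRegularOfDegree 7) (x : G.Dart) :
    mooreBound 7 G.girth ≤ Fintype.card V := by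
  rw [← card_ballVerts hh hreg x]
  exact card_le_univ _

theorem card_dart (hreg : G.IsRegularOfDegree 7) : Fintype.card G.Dart = 7 * Fintype.card V := by
  rw [G.dart_card_eq_sum_degrees, Finset.sum_const_nat (fun v _ => hreg v), card_univ, mul_comm]

theorem card_filter_fst_notMem (hh : G.girth = 2 * h) (hreg : G.IsRegularOfDegree 7)
    (x : G.Dart) : (univ.filter fun y : G.Dart => y.fst ∉ ballVerts h x).card
      + 7 * mooreBound 7 G.girth = 7 * Fintype.card V := by
  have h1 : (univ.filter fun y : G.Dart => y.fst ∈ ballVerts h x).card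
      = 7 * mooreBound 7 G.girth := by
    rw [card_eq_sum_card_fiberwise (t := ballVerts h x) (f := fun y => y.fst)
      (fun y hy => by simpa using hy), Finset.sum_const_nat (m := 7), card_ballVerts hh hreg,
      mul_comm]
    intro v hv
    rw [← card_filter_fst_eq hreg v, filter_filter]
    congr 1
    ext d
    simp only [mem_filter, mem_univ, true_and]
    exact ⟨fun h => h.2, fun h => ⟨h ▸ hv, h⟩⟩
  have h2 := card_filter_add_card_filter_not (s := (univ : Finset G.Dart))
    (fun y => y.fst ∈ ballVerts h x)
  rw [card_univ, card_dart hreg] at h2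
  omega

theorem sum_dart_eq (hh : G.girth = 2 * h) (x : G.Dart) {M : Type*} [AddCommMonoid M]
    (F : G.Dart → M) : ∑ y, F y = ∑ z ∈ tree h x, ∑ y with y.fst = z.fst, F y
      + ∑ y with y.fst ∉ ballVerts h x, F y := by
  rw [← Finset.sum_filter_add_sum_filter_not univ (fun y : G.Dart => y.fst ∈ ballVerts h x)]
  congr 1
  rw [← Finset.sum_fiberwise_of_maps_to (t := ballVerts h x) (g := fun y => y.fst)
    (fun y hy => by simpa using hy), ballVerts, Finset.sum_image (fst_injOn_tree hh x)]
  refine Finset.sum_congr rfl fun z hz => ?_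
  refine Finset.sum_congr ?_ fun _ _ => rfl
  ext d
  simp only [mem_filter, mem_univ, true_and]
  exact ⟨fun h => h.2, fun h => ⟨h ▸ mem_image_of_mem _ hz, h⟩⟩

theorem filter_fst_eq_insert (z : G.Dart) :
    (univ.filter fun y : G.Dart => y.fst = z.fst) = insert z (siblings z) := by
  ext d
  simp only [mem_filter, mem_univ, true_and, mem_insert, mem_siblings]
  constructor
  · intro h
    by_cases e : d = z
    · exact Or.inl e
    · exact Or.inr ⟨h, e⟩
  · rintro (rfl | h)
    · rfl
    · exact h.1

theorem dist_le_girth_of_fst_mem_ballVerts (hh : G.girth = 2 * h) (h0 : 2 ≤ h) {x y : G.Dart}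
    (hy : y.fst ∈ ballVerts h x) : (arcGraph G).dist y x ≤ G.girth := by
  rw [ballVerts, mem_image] at hy
  obtain ⟨z, hz, e⟩ := hy
  rw [mem_tree, mem_halfTree, mem_halfTree] at hz
  rcases hz with ⟨k, hk, hz⟩ | ⟨k, hk, hz⟩
  · obtain ⟨⟨π, -, hc, -⟩, -⟩ := exists_paths_of_mem_branch (by omega) hz e.symm rfl
    have := dist_add_one_le_card_foot π
    split_ifs at hc <;> omega
  · obtain ⟨-, π, -, hc⟩ := exists_paths_of_mem_branch (by omega) hz e.symm rfl
    have := dist_add_one_le_card_foot π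
    rw [← x.symm_symm]
    split_ifs at hc <;> omega

theorem dist_le_two_mul_girth (hG : G.Connected) (hh : G.girth = 2 * h) (h0 : 2 ≤ h)
    (hreg : G.IsRegularOfDegree 7) (hn : Fintype.card V < 2 * mooreBound 7 G.girth)
    (x y : G.Dart) : (arcGraph G).dist x y ≤ 2 * G.girth := by
  have : Nonempty G.Dart := ⟨x⟩
  -- Each ball has N vertices and n < 2N; a dart rooted in both balls is within g of x and of y.
  have hne : ¬ Disjoint (ballVerts h x) (ballVerts h y) := by
    intro hd
    have h1 := card_union_of_disjoint hd
    have h2 := card_le_univ (ballVerts h x ∪ ballVerts h y)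
    rw [card_ballVerts hh hreg, card_ballVerts hh hreg] at h1
    omega
  obtain ⟨s, hx, hy⟩ := Finset.not_disjoint_iff.1 hne
  obtain ⟨z, -, rfl⟩ := mem_image.1 hx
  have h1 := dist_le_girth_of_fst_mem_ballVerts hh h0 hx
  have h2 := dist_le_girth_of_fst_mem_ballVerts hh h0 hy
  have h3 := (arcGraph_connected hG).dist_triangle (u := x) (v := z) (w := y)
  rw [SimpleGraph.dist_comm] at h1
  omega

/-- The lower bound for `delGain x y` at distance `D`. -/
def gainBound (g D : ℤ) : ℤ := (D - 1) * (2 * g - 2 * D) - 2 * D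

/-- Among the seven darts at a vertex of depth k, z is at distance 2k from x and its siblings at 2k
+ 1; to `x.symm` each is one further. As k < h, no distance exceeds g. -/
theorem sum_fiber_le_delGain (hG : G.Connected)
    (hc : ∀ v, ((arcGraph G).induce {v}ᶜ).Connected) (hreg : G.IsRegularOfDegree 7)
    (hh : G.girth = 2 * h) {k : ℕ} (hk : k < h) (h0 : 2 ≤ h) {x z : G.Dart}
    (hz : z ∈ branch k x) :
    (gainBound G.girth (2 * k) + 6 * gainBound G.girth (2 * k + 1) ≤
      ∑ y with y.fst = z.fst, delGain y x) ∧
    gainBound G.girth (2 * k + 1) + 6 * gainBound G.girth (2 * k + 2) ≤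
      ∑ y with y.fst = z.fst, delGain y x.symm := by
  have hzn : z ∉ siblings z := by simp [mem_siblings]
  have hcard : ∀ c : ℤ, 6 * c = ∑ y ∈ siblings z, c := by
    intro c; rw [Finset.sum_const, card_siblings hreg, nsmul_eq_mul]; norm_num
  have hs : ∀ y ∈ siblings z, y.fst = z.fst ∧ y ≠ z := fun y hy => mem_siblings.1 hy
  rw [filter_fst_eq_insert, Finset.sum_insert hzn, Finset.sum_insert hzn, hcard, hcard]
  constructor
  · refine add_le_add ?_ (Finset.sum_le_sum fun y hy => ?_)
    · obtain ⟨⟨π, hπ, hcd, -⟩, -⟩ := exists_paths_of_mem_branch (by omega) hz rfl rfl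
      rw [if_pos rfl] at hcd
      have := le_delGain_of_card_foot hG hc hπ hcd (by omega)
      push_cast at this
      simpa [gainBound] using this
    · obtain ⟨⟨π, hπ, hcd, -⟩, -⟩ := exists_paths_of_mem_branch (by omega) hz (hs y hy).1 rfl
      rw [if_neg (hs y hy).2] at hcd
      have := le_delGain_of_card_foot hG hc hπ hcd (by omega)
      push_cast at this
      simpa [gainBound] using this
  · refine add_le_add ?_ (Finset.sum_le_sum fun y hy => ?_)
    · obtain ⟨-, π, hπ, hcd⟩ := exists_paths_of_mem_branch (by omega) hz rfl rfl
      rw [if_pos rfl] at hcd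
      have := le_delGain_of_card_foot hG hc hπ (D := 2 * k + 1) (by omega) (by omega)
      push_cast at this
      simpa [gainBound] using this
    · obtain ⟨-, π, hπ, hcd⟩ := exists_paths_of_mem_branch (by omega) hz (hs y hy).1 rfl
      rw [if_neg (hs y hy).2] at hcd
      have := le_delGain_of_card_foot hG hc hπ (D := 2 * k + 2) (by omega) (by omega)
      push_cast at this
      simpa [gainBound] using this

/-- Adding the two branches gives the coefficients 1, 7, 6. The 7(n − N) darts rooted outside the
ball are within 2g of x, so each loses at most 4g. -/
theorem le_sum_delGain (hG : G.Connected)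
    (hc : ∀ v, ((arcGraph G).induce {v}ᶜ).Connected) (hreg : G.IsRegularOfDegree 7)
    (hh : G.girth = 2 * h) (h0 : 2 ≤ h) (hn : Fintype.card V < 2 * mooreBound 7 G.girth)
    (x : G.Dart) :
    ∑ k ∈ range h, 6 ^ k * (gainBound G.girth (2 * k) + 7 * gainBound G.girth (2 * k + 1)
      + 6 * gainBound G.girth (2 * k + 2))
      - 28 * G.girth * ((Fintype.card V : ℤ) - mooreBound 7 G.girth) ≤ ∑ y, delGain y x := by
  rw [sum_dart_eq hh x, sum_tree hh, sub_eq_add_neg]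
  refine add_le_add (Finset.sum_le_sum fun k hk => ?_) ?_
  · rw [mem_range] at hk
    have h1 : ∀ z ∈ branch k x, _ := fun z hz =>
      (sum_fiber_le_delGain hG hc hreg hh hk h0 hz).1
    have h2 : ∀ z ∈ branch k x.symm, _ := fun z hz =>
      (sum_fiber_le_delGain hG hc hreg hh hk h0 hz).2
    rw [Dart.symm_symm] at h2
    have h3 := Finset.sum_le_sum h1
    have h4 := Finset.sum_le_sum h2
    rw [Finset.sum_const, card_branch hreg x (by omega), nsmul_eq_mul] at h3
    rw [Finset.sum_const, card_branch hreg x.symm (by omega), nsmul_eq_mul] at h4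
    push_cast at h3 h4
    linarith
  · have h1 : ∀ y ∈ univ.filter (fun y : G.Dart => y.fst ∉ ballVerts h x),
        -4 * (G.girth : ℤ) ≤ delGain y x := by
      intro y _
      have h2 := neg_two_mul_dist_le_delGain hc y x
      have h3 := dist_le_two_mul_girth hG hh h0 hreg hn y x
      zify at h3
      linarith
    have h2 := Finset.sum_le_sum h1
    rw [Finset.sum_const, nsmul_eq_mul] at h2
    have h3 := card_filter_fst_notMem hh hreg x
    zify at h3
    refine le_trans (le_of_eq ?_) h2
    rw [eq_sub_of_add_eq h3]
    ring

end Trees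

/-! ### The total distance as a sum over ordered pairs. -/

section Wiener

variable {α β : Type*} [Fintype α] [DecidableEq α] [Fintype β] [DecidableEq β]

theorem two_mul_wienerIndex (Γ : SimpleGraph α) :
    2 * wienerIndex Γ = ∑ x, ∑ y, Γ.dist x y := by
  rw [wienerIndex, finsum_eq_sum_of_fintype, ← Fintype.sum_prod_type',
    ← Finset.sum_fiberwise_of_maps_to (t := univ) (g := fun p : α × α => s(p.1, p.2))
      (fun _ _ => mem_univ _), Finset.mul_sum]
  refine Finset.sum_congr rfl fun e _ => ?_
  induction e with
  | _ a b =>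
    by_cases hab : a = b
    · subst hab
      have : (univ.filter fun p : α × α => s(p.1, p.2) = s(a, a)) = {(a, a)} := by
        ext ⟨p, q⟩; simp
      rw [this]; simp
    · have : (univ.filter fun p : α × α => s(p.1, p.2) = s(a, b)) = {(a, b), (b, a)} := by
        ext ⟨p, q⟩; simp
      rw [this, Finset.sum_pair (by simp [hab])]
      simp only [Sym2.lift_mk]
      rw [SimpleGraph.dist_comm (u := b)]
      ring

theorem dist_iso {Γ : SimpleGraph α} {Δ : SimpleGraph β} (φ : Γ ≃g Δ) (x y : α) :
    Δ.dist (φ x) (φ y) = Γ.dist x y := by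
  by_cases h : Γ.Reachable x y
  · apply le_antisymm
    · obtain ⟨w, hw⟩ := h.exists_walk_length_eq_dist
      rw [← hw, ← Walk.length_map φ.toHom w]
      exact dist_le _
    · obtain ⟨w, hw⟩ := (φ.reachable_iff.2 h).exists_walk_length_eq_dist
      have := dist_le ((w.map φ.symm.toHom).copy (φ.symm_apply_apply x) (φ.symm_apply_apply y))
      rwa [Walk.length_copy, Walk.length_map, hw] at this
  · rw [dist_eq_zero_of_not_reachable h,
      dist_eq_zero_of_not_reachable (mt φ.reachable_iff.1 h)]

theorem wienerIndex_iso {Γ : SimpleGraph α} {Δ : SimpleGraph β} (φ : Γ ≃g Δ) :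
    wienerIndex Γ = wienerIndex Δ := by
  have h1 := two_mul_wienerIndex Γ
  have h2 := two_mul_wienerIndex Δ
  rw [← Equiv.sum_comp φ.toEquiv] at h2
  simp_rw [← Equiv.sum_comp φ.toEquiv (fun y => Δ.dist _ y)] at h2
  have h3 : ∀ x y, Δ.dist (φ.toEquiv x) (φ.toEquiv y) = Γ.dist x y := dist_iso φ
  simp_rw [h3] at h2
  omega

theorem sum_compl_singleton {M : Type*} [AddCommMonoid M] (v : α) (F : α → M) :
    ∑ z : ({v}ᶜ : Set α), F z = ∑ z, if z = v then 0 else F z := by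
  rw [← Finset.sum_subtype (univ.filter fun z => z ≠ v) (by simp) F, Finset.sum_filter]
  refine Finset.sum_congr rfl fun z _ => ?_
  by_cases h : z = v <;> simp [h]

theorem two_mul_wienerIndex_induce (Γ : SimpleGraph α) (v : α) :
    2 * wienerIndex (Γ.induce {v}ᶜ) = ∑ x, ∑ y, delDist Γ v x y := by
  have h1 : ∀ x y : ({v}ᶜ : Set α), (Γ.induce {v}ᶜ).dist x y = delDist Γ v x y := fun x y => by
    rw [delDist, dif_pos ⟨x.2, y.2⟩]
  have h2 := two_mul_wienerIndex (Γ.induce {v}ᶜ)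
  simp_rw [h1] at h2
  rw [h2, sum_compl_singleton v fun x => ∑ y : ({v}ᶜ : Set α), delDist Γ v x y]
  refine Finset.sum_congr rfl fun x _ => ?_
  by_cases hx : x = v
  · subst hx; simp [delDist_left]
  · rw [if_neg hx, sum_compl_singleton v fun y => delDist Γ v x y]
    refine Finset.sum_congr rfl fun y _ => ?_
    by_cases hy : y = v
    · subst hy; simp [delDist_right]
    · rw [if_neg hy]

end Wiener

/-! ### Distances and total distance after attaching a tree. -/

section Attach

variable {α β : Type*} {Γ : SimpleGraph α} {T : SimpleGraph β} {x y : α} {r : β}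

@[simp] theorem attachAt_inl_inl {a b : α} :
    (attachAt Γ x y T r).Adj (Sum.inl a) (Sum.inl b) ↔ Γ.Adj a b := by
  simp [attachAt, edge_adj]

@[simp] theorem attachAt_inr_inr {s t : β} :
    (attachAt Γ x y T r).Adj (Sum.inr s) (Sum.inr t) ↔ T.Adj s t := by
  simp [attachAt, edge_adj]

@[simp] theorem attachAt_inl_inr {a : α} {t : β} :
    (attachAt Γ x y T r).Adj (Sum.inl a) (Sum.inr t) ↔ (a = x ∨ a = y) ∧ t = r := by
  simp [attachAt, edge_adj]
  tauto

@[simp] theorem attachAt_inr_inl {a : α} {t : β} :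
    (attachAt Γ x y T r).Adj (Sum.inr t) (Sum.inl a) ↔ (a = x ∨ a = y) ∧ t = r := by
  rw [SimpleGraph.adj_comm, attachAt_inl_inr]

/-- The inclusion of the first part. -/
def attachInl (Γ : SimpleGraph α) (x y : α) (T : SimpleGraph β) (r : β) :
    Γ →g attachAt Γ x y T r where
  toFun := Sum.inl
  map_rel' h := attachAt_inl_inl.2 h

/-- The inclusion of the second part. -/
def attachInr (Γ : SimpleGraph α) (x y : α) (T : SimpleGraph β) (r : β) :
    T →g attachAt Γ x y T r where
  toFun := Sum.inr
  map_rel' h := attachAt_inr_inr.2 h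

theorem attachAt_connected (hΓ : Γ.Connected) (hT : T.Connected) :
    (attachAt Γ x y T r).Connected := by
  have hx : ∀ z, (attachAt Γ x y T r).Reachable z (Sum.inl x) := by
    rintro (a | t)
    · exact (hΓ.preconnected a x).map (attachInl Γ x y T r)
    · refine ((hT.preconnected t r).map (attachInr Γ x y T r)).trans (Adj.reachable ?_)
      exact attachAt_inr_inl.2 ⟨Or.inl rfl, rfl⟩
  exact { preconnected := fun a b => (hx a).trans (hx b).symm, nonempty := ⟨Sum.inl x⟩ }

/-- Potentials that rise by at most 1 along edges supply the lower bounds for distances in the glued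
graph and in the rooted trees. -/
theorem le_add_dist {γ : Type*} {Δ : SimpleGraph γ} (hΔ : Δ.Connected) {f : γ → ℤ}
    (hf : ∀ a b, Δ.Adj a b → f b ≤ f a + 1) (a b : γ) : f b ≤ f a + Δ.dist a b := by
  obtain ⟨w, hw⟩ := hΔ.exists_walk_length_eq_dist a b
  rw [← hw]
  clear hw
  induction w with
  | nil => simp
  | cons h p ih =>
    have := hf _ _ h
    rw [Walk.length_cons]
    push_cast
    linarith

theorem dist_le_dist_add_one {Δ : SimpleGraph α} (hΔ : Δ.Connected) {a b : α} (h : Δ.Adj a b)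
    (c : α) : Δ.dist c b ≤ Δ.dist c a + 1 := by
  have h1 := hΔ.dist_triangle (u := c) (v := a) (w := b)
  rwa [dist_eq_one_iff_adj.2 h] at h1

theorem dist_attachAt_inl_inl (hΓ : Γ.Connected) (hT : T.Connected) (hxy : Γ.Adj x y) (a b : α) :
    (attachAt Γ x y T r).dist (Sum.inl a) (Sum.inl b) = Γ.dist a b := by
  apply le_antisymm
  · obtain ⟨w, hw⟩ := hΓ.exists_walk_length_eq_dist a b
    rw [← hw, ← Walk.length_map (attachInl Γ x y T r) w]
    exact dist_le _
  · have := le_add_dist (attachAt_connected hΓ hT (x := x) (y := y) (r := r))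
      -- A constant on the attached part suffices: x and y are adjacent, so a passage through r is
      -- no shortcut.
      (f := Sum.elim (fun z => (Γ.dist a z : ℤ)) fun _ => Γ.dist a x) ?_ (Sum.inl a) (Sum.inl b)
    · simp only [Sum.elim_inl, SimpleGraph.dist_self] at this
      omega
    · have h1 := dist_le_dist_add_one hΓ hxy a
      have h2 := dist_le_dist_add_one hΓ hxy.symm a
      rintro (z | s) (z' | s') h
      · have := dist_le_dist_add_one hΓ (attachAt_inl_inl.1 h) a
        simp only [Sum.elim_inl]; omega
      · obtain ⟨rfl | rfl, -⟩ := attachAt_inl_inr.1 h <;> simp only [Sum.elim_inl, Sum.elim_inr] <;>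
          omega
      · obtain ⟨rfl | rfl, -⟩ := attachAt_inr_inl.1 h <;> simp only [Sum.elim_inl, Sum.elim_inr] <;>
          omega
      · simp

theorem dist_attachAt_inr_inr (hΓ : Γ.Connected) (hT : T.Connected) (s t : β) :
    (attachAt Γ x y T r).dist (Sum.inr s) (Sum.inr t) = T.dist s t := by
  apply le_antisymm
  · obtain ⟨w, hw⟩ := hT.exists_walk_length_eq_dist s t
    rw [← hw, ← Walk.length_map (attachInr Γ x y T r) w]
    exact dist_le _
  · have := le_add_dist (attachAt_connected hΓ hT (x := x) (y := y) (r := r))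
      (f := Sum.elim (fun _ => (T.dist s r : ℤ)) fun z => T.dist s z) ?_ (Sum.inr s) (Sum.inr t)
    · simp only [Sum.elim_inr, SimpleGraph.dist_self] at this
      omega
    · rintro (z | u) (z' | u') h
      · simp
      · obtain ⟨-, rfl⟩ := attachAt_inl_inr.1 h
        simp
      · obtain ⟨-, rfl⟩ := attachAt_inr_inl.1 h
        simp
      · have := dist_le_dist_add_one hT (attachAt_inr_inr.1 h) s
        simp only [Sum.elim_inr]; omega

theorem dist_attachAt_inl_inr (hΓ : Γ.Connected) (hT : T.Connected) (a : α) (t : β) :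
    (attachAt Γ x y T r).dist (Sum.inl a) (Sum.inr t)
      = min (Γ.dist a x) (Γ.dist a y) + 1 + T.dist r t := by
  have hc := attachAt_connected hΓ hT (x := x) (y := y) (r := r)
  apply le_antisymm
  · have key : ∀ z, z = x ∨ z = y → (attachAt Γ x y T r).dist (Sum.inl a) (Sum.inr t)
        ≤ Γ.dist a z + 1 + T.dist r t := by
      intro z hz
      have h1 := hc.dist_triangle (u := Sum.inl a) (v := Sum.inl z) (w := Sum.inr t)
      have h2 := hc.dist_triangle (u := Sum.inl z) (v := Sum.inr r) (w := Sum.inr t)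
      rw [dist_attachAt_inr_inr hΓ hT,
        dist_eq_one_iff_adj.2 (attachAt_inl_inr.2 ⟨hz, rfl⟩)] at h2
      obtain ⟨w, hw⟩ := hΓ.exists_walk_length_eq_dist a z
      have h3 := dist_le (w.map (attachInl Γ x y T r))
      rw [Walk.length_map, hw] at h3
      have h3' : (attachAt Γ x y T r).dist (Sum.inl a) (Sum.inl z) ≤ Γ.dist a z := h3
      omega
    have h1 := key x (Or.inl rfl)
    have h2 := key y (Or.inr rfl)
    rcases min_choice (Γ.dist a x) (Γ.dist a y) with h | h <;> omega
  · have := le_add_dist hc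
      (f := Sum.elim (fun z => -(min (Γ.dist z x) (Γ.dist z y) : ℤ)) fun s => 1 + T.dist r s)
      ?_ (Sum.inl a) (Sum.inr t)
    · simp only [Sum.elim_inl, Sum.elim_inr] at this
      zify
      linarith
    · rintro (z | s) (z' | s') h
      · have h1 := dist_le_dist_add_one hΓ (attachAt_inl_inl.1 h).symm x
        have h2 := dist_le_dist_add_one hΓ (attachAt_inl_inl.1 h).symm y
        rw [SimpleGraph.dist_comm, SimpleGraph.dist_comm (u := x)] at h1
        rw [SimpleGraph.dist_comm, SimpleGraph.dist_comm (u := y)] at h2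
        simp only [Sum.elim_inl]; omega
      · obtain ⟨rfl | rfl, rfl⟩ := attachAt_inl_inr.1 h <;> simp
      · obtain ⟨rfl | rfl, rfl⟩ := attachAt_inr_inl.1 h <;> simp only [Sum.elim_inl, Sum.elim_inr, SimpleGraph.dist_self] <;> omega
      · have := dist_le_dist_add_one hT (attachAt_inr_inr.1 h) r
        simp only [Sum.elim_inr]; omega

theorem wienerIndex_attachAt [Fintype α] [DecidableEq α] [Fintype β] [DecidableEq β]
    (hΓ : Γ.Connected) (hT : T.Connected) (hxy : Γ.Adj x y) :
    wienerIndex (attachAt Γ x y T r) = wienerIndex Γ + wienerIndex T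
      + ∑ z, ∑ t, (min (Γ.dist z x) (Γ.dist z y) + 1 + T.dist r t) := by
  have h1 := two_mul_wienerIndex (attachAt Γ x y T r)
  have h2 := two_mul_wienerIndex Γ
  have h3 := two_mul_wienerIndex T
  simp only [Fintype.sum_sum_type, dist_attachAt_inl_inl hΓ hT hxy, dist_attachAt_inr_inr hΓ hT,
    dist_attachAt_inl_inr hΓ hT, SimpleGraph.dist_comm (u := Sum.inr _) (v := Sum.inl _)] at h1
  rw [Finset.sum_add_distrib, Finset.sum_add_distrib, Finset.sum_comm (s := (univ : Finset β))
    (t := (univ : Finset α))] at h1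
  omega

/-- Deleting a vertex of the first part commutes with attaching the second part. -/
noncomputable def attachInduceIso {v : α} (hx : x ≠ v) (hy : y ≠ v) :
    attachAt (Γ.induce {v}ᶜ) ⟨x, hx⟩ ⟨y, hy⟩ T r ≃g
      (attachAt Γ x y T r).induce {Sum.inl v}ᶜ where
  toEquiv :=
    { toFun := Sum.elim (fun a => ⟨Sum.inl a.1, fun h => a.2 (Sum.inl_injective h)⟩)
        fun t => ⟨Sum.inr t, fun h => Sum.inr_ne_inl h⟩
      invFun := fun z => match z with
        | ⟨Sum.inl a, ha⟩ => Sum.inl ⟨a, fun h => ha (congrArg Sum.inl h)⟩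
        | ⟨Sum.inr t, _⟩ => Sum.inr t
      left_inv := by rintro (a | t) <;> rfl
      right_inv := by rintro ⟨a | t, h⟩ <;> rfl }
  map_rel_iff' := by
    rintro (a | t) (b | s)
    · exact (attachAt_inl_inl (Γ := Γ) (a := a.1) (b := b.1)).trans
        (attachAt_inl_inl (Γ := Γ.induce {v}ᶜ)).symm
    · refine attachAt_inl_inr.trans (Iff.trans ?_ attachAt_inl_inr.symm)
      simp [Subtype.ext_iff]
    · refine attachAt_inr_inl.trans (Iff.trans ?_ attachAt_inr_inl.symm)
      simp [Subtype.ext_iff]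
    · exact attachAt_inr_inr.trans attachAt_inr_inr.symm

/-- By `hd` the distances of the other vertices to `T` survive, so the total distance gains its
change within `Γ` and loses the distances from v to `T`; `hW` balances the two. -/
theorem isSoltesVertex_attachAt [Fintype α] [DecidableEq α] [Fintype β] [DecidableEq β]
    (hΓ : Γ.Connected) (hT : T.Connected) (hxy : Γ.Adj x y) {v : α} (hx : x ≠ v) (hy : y ≠ v)
    (hv : (Γ.induce {v}ᶜ).Connected)
    (hd : ∀ z, z ≠ v → min (delDist Γ v z x) (delDist Γ v z y) = min (Γ.dist z x) (Γ.dist z y))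
    (hW : (wienerIndex (Γ.induce {v}ᶜ) : ℤ) - wienerIndex Γ
      = ∑ t, (min (Γ.dist v x) (Γ.dist v y) + 1 + T.dist r t : ℤ)) :
    IsSoltesVertex (attachAt Γ x y T r) (Sum.inl v) := by
  let φ := attachInduceIso (Γ := Γ) (T := T) (r := r) hx hy
  have hadj : (Γ.induce {v}ᶜ).Adj ⟨x, hx⟩ ⟨y, hy⟩ := hxy
  refine ⟨φ.connected_iff.1 (attachAt_connected hv hT), ?_⟩
  rw [← wienerIndex_iso φ, wienerIndex_attachAt hv hT hadj, wienerIndex_attachAt hΓ hT hxy]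
  have h1 : ∀ z : ({v}ᶜ : Set α), min ((Γ.induce {v}ᶜ).dist z ⟨x, hx⟩)
      ((Γ.induce {v}ᶜ).dist z ⟨y, hy⟩) = min (Γ.dist z x) (Γ.dist z y) := by
    intro z
    rw [← hd z z.2, delDist, dif_pos ⟨z.2, hx⟩, delDist, dif_pos ⟨z.2, hy⟩]
  simp_rw [h1]
  rw [sum_compl_singleton v fun z => ∑ t, (min (Γ.dist z x) (Γ.dist z y) + 1 + T.dist r t),
    ← Finset.add_sum_erase univ (fun z => ∑ t, (min (Γ.dist z x) (Γ.dist z y) + 1 + T.dist r t))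
      (mem_univ v),
    ← Finset.add_sum_erase univ (fun z => if z = v then 0 else
      ∑ t, (min (Γ.dist z x) (Γ.dist z y) + 1 + T.dist r t)) (mem_univ v), if_pos rfl, zero_add]
  have h2 : ∑ z ∈ univ.erase v, (if z = v then 0 else
      ∑ t, (min (Γ.dist z x) (Γ.dist z y) + 1 + T.dist r t)) =
      ∑ z ∈ univ.erase v, ∑ t, (min (Γ.dist z x) (Γ.dist z y) + 1 + T.dist r t) :=
    Finset.sum_congr rfl fun z hz => if_neg (ne_of_mem_erase hz)
  rw [h2]
  zify
  push_cast at hW ⊢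
  linarith

end Attach

/-! ### The change under deletion is the same for all arcs. -/

section Constant

variable {V : Type*} [Fintype V] [DecidableEq V] {G : SimpleGraph V} [DecidableRel G.Adj]

/-- The action of an automorphism of `G` on the arc-graph. -/
def arcIso (φ : G ≃g G) : arcGraph G ≃g arcGraph G where
  toFun d := ⟨(φ d.fst, φ d.snd), φ.map_rel_iff.2 d.adj⟩
  invFun d := ⟨(φ.symm d.fst, φ.symm d.snd), φ.symm.map_rel_iff.2 d.adj⟩
  left_inv d := by ext <;> simp
  right_inv d := by ext <;> simp
  map_rel_iff' := by
    intro a b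
    simp [arcGraph, Dart.ext_iff, Prod.ext_iff]

/-- Deleting a vertex of the arc-graph changes the Wiener index by an amount that does not depend
on the vertex. -/
theorem wienerIndex_induce_eq (hG : IsArcTransitive G) (v w : G.Dart) :
    wienerIndex ((arcGraph G).induce {v}ᶜ) = wienerIndex ((arcGraph G).induce {w}ᶜ) := by
  obtain ⟨φ, h1, h2⟩ := hG v.fst v.snd w.fst w.snd v.adj w.adj
  have hvw : arcIso φ v = w := by
    ext
    · exact h1
    · exact h2
  have hst : Set.BijOn (arcIso φ) {v}ᶜ {w}ᶜ := by
    refine ⟨fun z hz e => hz ?_, (arcIso φ).injective.injOn, fun z hz => ?_⟩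
    · exact (arcIso φ).injective (e.trans hvw.symm)
    · refine ⟨(arcIso φ).symm z, fun e => hz ?_, (arcIso φ).apply_symm_apply z⟩
      rw [Set.mem_singleton_iff] at e ⊢
      rw [← hvw, ← e, RelIso.apply_symm_apply]
  exact wienerIndex_iso ((arcIso φ).induce hst)

theorem exists_wienerIndex_sub_eq (hG : IsArcTransitive G) [Nonempty G.Dart] :
    ∃ c : ℤ, (∀ v, (wienerIndex ((arcGraph G).induce {v}ᶜ) : ℤ) - wienerIndex (arcGraph G) = c) ∧
      Fintype.card G.Dart * (2 * c) = ∑ x : G.Dart, ∑ y : G.Dart, delGain y x := by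
  obtain ⟨v₀⟩ := ‹Nonempty G.Dart›
  refine ⟨wienerIndex ((arcGraph G).induce {v₀}ᶜ) - wienerIndex (arcGraph G), fun v => ?_, ?_⟩
  · rw [wienerIndex_induce_eq hG v v₀]
  · have h1 : ∀ v : G.Dart, 2 * ((wienerIndex ((arcGraph G).induce {v₀}ᶜ) : ℤ)
        - wienerIndex (arcGraph G)) = ∑ x, ∑ y, ((delDist (arcGraph G) v y x : ℤ)
          - (arcGraph G).dist y x) := by
      intro v
      have h2 := two_mul_wienerIndex_induce (arcGraph G) v
      have h3 := two_mul_wienerIndex (arcGraph G)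
      rw [wienerIndex_induce_eq hG v v₀, Finset.sum_comm] at h2
      rw [Finset.sum_comm] at h3
      zify at h2 h3
      simp_rw [Finset.sum_sub_distrib]
      rw [← h2, ← h3]
      ring
    -- Summing over all deleted vertices and regrouping by pairs turns the constant into a sum of
    -- `delGain`.
    have h2 := Finset.sum_congr (rfl : (univ : Finset G.Dart) = univ) fun v _ => h1 v
    rw [Finset.sum_const, card_univ, nsmul_eq_mul] at h2
    rw [h2, Finset.sum_comm]
    refine Finset.sum_congr rfl fun x _ => ?_
    rw [Finset.sum_comm]
    rfl

end Constant

/-! ### Inner leaves: their number and their distances. -/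

section Good

variable {V : Type*} [Fintype V] [DecidableEq V] {G : SimpleGraph V} [DecidableRel G.Adj] {h : ℕ}

/-- The leaves of the ball around the edge of `x` in the arc-graph. -/
def leaves (h : ℕ) (x : G.Dart) : Finset G.Dart :=
  (branch (h - 1) x ∪ branch (h - 1) x.symm).biUnion siblings

/-- The leaves on edges that stay inside the ball. -/
def innerLeaves (h : ℕ) (x : G.Dart) : Finset G.Dart :=
  (leaves h x).filter fun y => y.snd ∈ ballVerts h x

theorem card_leaves (hh : G.girth = 2 * h) (h0 : 2 ≤ h) (hreg : G.IsRegularOfDegree 7)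
    (x : G.Dart) : (leaves h x).card = 12 * 6 ^ (h - 1) := by
  have hsub : ∀ z ∈ branch (h - 1) x ∪ branch (h - 1) x.symm, z ∈ tree h x := by
    intro z hz
    rw [mem_tree, mem_halfTree, mem_halfTree]
    rcases mem_union.1 hz with hz | hz
    · exact Or.inl ⟨h - 1, by omega, hz⟩
    · exact Or.inr ⟨h - 1, by omega, hz⟩
  rw [leaves, card_biUnion, Finset.sum_const_nat (fun z _ => card_siblings hreg z),
    card_union_of_disjoint, card_branch hreg x (by omega), card_branch hreg x.symm (by omega)]
  · ring
  · refine Finset.disjoint_left.2 fun z h1 h2 => ?_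
    exact fst_ne_of_mem_branch_symm (by omega) h1 h2 rfl
  · intro a ha b hb hab
    refine Finset.disjoint_left.2 fun d hda hdb => ?_
    rw [mem_siblings] at hda hdb
    exact hab (fst_injOn_tree hh x (hsub a ha) (hsub b hb) (hda.1.symm.trans hdb.1))

/-- Reversing a leaf that leaves the ball gives a dart rooted outside, and there are 7(n − N) of
those. -/
theorem card_innerLeaves (hh : G.girth = 2 * h) (h0 : 2 ≤ h) (hreg : G.IsRegularOfDegree 7)
    (x : G.Dart) : 12 * 6 ^ (h - 1) + 7 * mooreBound 7 G.girth ≤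
      (innerLeaves h x).card + 7 * Fintype.card V := by
  have h1 := card_filter_add_card_filter_not (s := leaves h x) (fun y => y.snd ∈ ballVerts h x)
  have h2 : ((leaves h x).filter fun y => ¬ y.snd ∈ ballVerts h x).card ≤
      (univ.filter fun y : G.Dart => y.fst ∉ ballVerts h x).card := by
    refine card_le_card_of_injOn Dart.symm (fun y hy => ?_) Dart.symm_involutive.injective.injOn
    simp only [coe_filter, Set.mem_ofPred_eq, mem_univ, true_and] at hy ⊢
    exact hy.2
  have h3 := card_filter_fst_notMem hh hreg x
  rw [card_leaves hh h0 hreg] at h1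
  unfold innerLeaves
  omega

theorem five_mul_mooreBound_le (hh : G.girth = 2 * h) (h0 : 2 ≤ h) :
    5 * mooreBound 7 G.girth ≤ 12 * 6 ^ (h - 1) := by
  rw [mooreBound_eq hh]
  obtain ⟨k, rfl⟩ : ∃ k, h = k + 1 := ⟨h - 1, by omega⟩
  have : ∀ m, 5 * ∑ i ∈ range m, 6 ^ i + 1 = 6 ^ m := by
    intro m
    induction m with
    | zero => simp
    | succ m ih => rw [Finset.sum_range_succ, pow_succ]; omega
  have h1 := this (k + 1)
  rw [pow_succ] at h1
  rw [Nat.add_sub_cancel]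
  omega

theorem delDist_le_two_mul_length_add_one {v y s : G.Dart} {π : G.Walk y.fst s.fst}
    (hπ : π.IsPath) (hy : y ≠ v) (hs : s ≠ v) (hv : v.edge ∉ π.edges) :
    delDist (arcGraph G) v y s ≤ 2 * π.length + 1 := by
  by_cases hys : y = s
  · subst hys; rw [delDist_self]; omega
  · have h1 := delDist_add_one_le_card_foot π (notMem_foot hy hs hv)
    rw [card_foot hys hπ] at h1
    split_ifs at h1 <;> omega

theorem dist_le_two_mul_length_add_one {y s : G.Dart} {π : G.Walk y.fst s.fst}
    (hπ : π.IsPath) : (arcGraph G).dist y s ≤ 2 * π.length + 1 := by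
  by_cases hys : y = s
  · subst hys; rw [SimpleGraph.dist_self]; omega
  · have h1 := dist_add_one_le_card_foot π
    rw [card_foot hys hπ] at h1
    split_ifs at h1 <;> omega

/-- Inner leaves are at distance `g - 1` from the edge of `x`, and deleting one does not change
the distances of the other vertices to this edge. -/
theorem innerLeaf_of_mem_branch (hG : G.Connected)
    (hc : ∀ v, ((arcGraph G).induce {v}ᶜ).Connected) (hh : G.girth = 2 * h) (h0 : 2 ≤ h)
    {x v z : G.Dart} (hz : z ∈ branch (h - 1) x) (hvz : v ∈ siblings z)
    (hv : v.snd ∈ ballVerts h x) :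
    x ≠ v ∧ x.symm ≠ v ∧
    min ((arcGraph G).dist v x) ((arcGraph G).dist v x.symm) = G.girth - 1 ∧
    ∀ y, y ≠ v → min (delDist (arcGraph G) v y x) (delDist (arcGraph G) v y x.symm)
      = min ((arcGraph G).dist y x) ((arcGraph G).dist y x.symm) := by
  rw [mem_siblings] at hvz
  obtain ⟨⟨π, hπ, hcd, hl, hvπ⟩, π', hπ', hcd'⟩ :=
    exists_paths_of_mem_branch (by omega) hz hvz.1 rfl
  rw [if_neg hvz.2] at hcd hcd'
  have hd : (arcGraph G).dist v x = G.girth - 1 := by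
    rw [dist_eq_of_card_foot hG hπ hcd (by omega)]; omega
  have hd' : (arcGraph G).dist v x.symm = G.girth := by
    rw [dist_eq_of_card_foot hG hπ' (D := G.girth) (by omega) le_rfl]
  have hx : x ≠ v := by
    rintro rfl
    rw [SimpleGraph.dist_self] at hd
    omega
  have hx' : x.symm ≠ v := by
    rintro rfl
    rw [SimpleGraph.dist_self] at hd'
    omega
  have : Nonempty G.Dart := ⟨x⟩
  have hfar : ∀ s : G.Dart, s ∈ ({x, x.symm} : Set G.Dart) →
      s ≠ v ∧ G.girth - 1 ≤ (arcGraph G).dist v s := by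
    rintro s (rfl | rfl)
    · exact ⟨hx, hd.ge⟩
    · exact ⟨hx', by omega⟩
  -- A neighbour of v shares its root, and then follows π, or is the reverse of v, rooted in the
  -- ball because v is inner. Either way a path of length at most h − 1 gives distance at most 2(h −
  -- 1) + 1 = g − 1.
  have hnb : ∀ u, (arcGraph G).Adj u v → ∃ s ∈ ({x, x.symm} : Set G.Dart),
      delDist (arcGraph G) v u s ≤ G.girth - 1 := by
    rintro u ⟨huv, hfst | rfl⟩
    · refine ⟨x, by simp, ?_⟩
      have h1 := delDist_le_two_mul_length_add_one (v := v) (y := u) (s := x)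
        (π := π.copy hfst.symm rfl) ((Walk.isPath_copy _ _ _).2 hπ) huv hx
        (by rw [Walk.edges_copy]; exact mt hvπ hvz.2)
      rw [Walk.length_copy, hl] at h1
      omega
    · obtain ⟨s, k, z', hs, hk, hz', e⟩ : ∃ (s : G.Dart) (k : ℕ) (z' : G.Dart),
          s ∈ ({x, x.symm} : Set G.Dart) ∧ k < h ∧ z' ∈ branch k s ∧ z'.fst = u.fst := by
        rw [ballVerts, mem_image] at hv
        obtain ⟨z', hz', e⟩ := hv
        rw [mem_tree, mem_halfTree, mem_halfTree] at hz'
        rcases hz' with ⟨k, hk, hz'⟩ | ⟨k, hk, hz'⟩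
        · exact ⟨x, k, z', by simp, hk, hz', e⟩
        · exact ⟨x.symm, k, z', by simp, hk, hz', e⟩
      obtain ⟨ρ₀, hρ₀, hl₀, -⟩ := exists_path_of_mem_branch (by omega) hz'
      obtain ⟨ρ, hρ, hρl⟩ : ∃ ρ : G.Walk u.fst s.fst, ρ.IsPath ∧ ρ.length = k :=
        ⟨ρ₀.copy e rfl, (Walk.isPath_copy _ _ _).2 hρ₀, by rw [Walk.length_copy, hl₀]⟩
      refine ⟨s, hs, ?_⟩
      -- Otherwise the rest of ρ from the root of the deleted dart would have length at most h − 2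
      -- and put that dart within g − 3 of s.
      have hρv : u.symm.edge ∉ ρ.edges := by
        intro hmem
        rw [Dart.edge_symm] at hmem
        have hsnd : u.symm.fst ∈ ρ.support := ρ.snd_mem_support_of_mem_edges hmem
        have h1 := congrArg Walk.length (ρ.take_spec hsnd)
        rw [Walk.length_append] at h1
        have h2 : (ρ.takeUntil _ hsnd).length ≠ 0 := fun h0 =>
          u.adj.ne (Walk.eq_of_length_eq_zero h0)
        have h3 := dist_le_two_mul_length_add_one (y := u.symm) (s := s) (hρ.dropUntil hsnd)
        have h4 := (hfar s hs).2
        omega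
      have := delDist_le_two_mul_length_add_one hρ huv (hfar s hs).1 hρv
      omega
  refine ⟨hx, hx', by omega, fun y hy => ?_⟩
  have hloc := exists_delDist_le_dist (arcGraph_connected hG) (v := v) (S := {x, x.symm})
    (by simp [hx.symm, hx'.symm]) (hc v) (fun s hs => (hfar s hs).2) hnb hy
  have h1 := dist_le_delDist (hc v) hy hx
  have h2 := dist_le_delDist (hc v) hy hx'
  obtain ⟨t, ht, h3⟩ := hloc x (by simp)
  obtain ⟨t', ht', h4⟩ := hloc x.symm (by simp)
  rcases ht with rfl | rfl <;> rcases ht' with rfl | rfl <;> omega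

theorem innerLeaf_spec (hG : G.Connected)
    (hc : ∀ v, ((arcGraph G).induce {v}ᶜ).Connected) (hh : G.girth = 2 * h) (h0 : 2 ≤ h)
    {x v : G.Dart} (hv : v ∈ innerLeaves h x) :
    x ≠ v ∧ x.symm ≠ v ∧
    min ((arcGraph G).dist v x) ((arcGraph G).dist v x.symm) = G.girth - 1 ∧
    ∀ y, y ≠ v → min (delDist (arcGraph G) v y x) (delDist (arcGraph G) v y x.symm)
      = min ((arcGraph G).dist y x) ((arcGraph G).dist y x.symm) := by
  rw [innerLeaves, mem_filter, leaves, mem_biUnion] at hv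
  obtain ⟨⟨z, hz, hvz⟩, hv⟩ := hv
  rcases mem_union.1 hz with hz | hz
  · exact innerLeaf_of_mem_branch hG hc hh h0 hz hvz hv
  · have hb : ballVerts h x.symm = ballVerts h x := by
      rw [ballVerts, ballVerts, tree, tree, Dart.symm_symm, Finset.union_comm]
    obtain ⟨h1, h2, h3, h4⟩ := innerLeaf_of_mem_branch hG hc hh h0 hz hvz (hb ▸ hv)
    rw [Dart.symm_symm] at h2 h3 h4
    refine ⟨h2, h1, by rw [min_comm, h3], fun y hy => ?_⟩
    rw [min_comm, h4 y hy, min_comm]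

end Good

/-! ### Rooted trees with a prescribed sum of depths. -/

section RootedTrees

/-- The graph on `0, …, m` in which every `i ≠ 0` is joined to `par i`. -/
def parentGraph (m : ℕ) (par : ℕ → ℕ) : SimpleGraph (Fin (m + 1)) :=
  SimpleGraph.fromRel fun i j => (i : ℕ) ≠ 0 ∧ (j : ℕ) = par i

variable {m : ℕ} {par dep : ℕ → ℕ}

theorem exists_parent (hpar : ∀ i, i ≠ 0 → par i < i) {i : Fin (m + 1)} (hi : (i : ℕ) ≠ 0) :
    ∃ j : Fin (m + 1), (j : ℕ) = par i ∧ (parentGraph m par).Adj i j := by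
  have h := hpar i hi
  refine ⟨⟨par i, by omega⟩, rfl, ?_⟩
  rw [parentGraph, SimpleGraph.fromRel_adj]
  refine ⟨fun e => ?_, Or.inl ⟨hi, rfl⟩⟩
  have := congrArg Fin.val e
  simp only at this
  omega

theorem exists_walk_length_eq_depth (hpar : ∀ i, i ≠ 0 → par i < i) (h0 : dep 0 = 0)
    (hdep : ∀ i, i ≠ 0 → dep i = dep (par i) + 1) (i : Fin (m + 1)) :
    ∃ w : (parentGraph m par).Walk i 0, w.length = dep i := by
  obtain ⟨i, hi⟩ := i
  induction i using Nat.strong_induction_on with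
  | _ i ih =>
    by_cases h : i = 0
    · subst h
      exact ⟨Walk.nil, by simp [h0]⟩
    · obtain ⟨⟨j, hj⟩, e, hadj⟩ := exists_parent (m := m) hpar (i := ⟨i, hi⟩) h
      simp only at e
      obtain ⟨w, hw⟩ := ih j (e ▸ hpar i h) hj
      refine ⟨Walk.cons hadj w, ?_⟩
      rw [Walk.length_cons, hw]
      change dep j + 1 = dep i
      rw [hdep i h, e]

theorem parentGraph_connected (hpar : ∀ i, i ≠ 0 → par i < i) (h0 : dep 0 = 0)
    (hdep : ∀ i, i ≠ 0 → dep i = dep (par i) + 1) : (parentGraph m par).Connected where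
  preconnected i j := by
    obtain ⟨w, -⟩ := exists_walk_length_eq_depth hpar h0 hdep i
    obtain ⟨w', -⟩ := exists_walk_length_eq_depth hpar h0 hdep j
    exact ⟨w.append w'.reverse⟩
  nonempty := ⟨0⟩

theorem parentGraph_dist (hpar : ∀ i, i ≠ 0 → par i < i) (h0 : dep 0 = 0)
    (hdep : ∀ i, i ≠ 0 → dep i = dep (par i) + 1) (i : Fin (m + 1)) :
    (parentGraph m par).dist 0 i = dep i := by
  apply le_antisymm
  · obtain ⟨w, hw⟩ := exists_walk_length_eq_depth hpar h0 hdep i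
    rw [SimpleGraph.dist_comm, ← hw]
    exact dist_le w
  · have := le_add_dist (parentGraph_connected (m := m) hpar h0 hdep)
      (f := fun i => (dep i : ℤ)) ?_ 0 i
    · simp only [Fin.val_zero, h0] at this
      omega
    · intro a b hab
      rw [parentGraph, SimpleGraph.fromRel_adj] at hab
      rcases hab.2 with ⟨h1, h2⟩ | ⟨h1, h2⟩
      · have := hdep a h1
        rw [← h2] at this
        omega
      · have := hdep b h1
        rw [← h2] at this
        omega

theorem parentGraph_isTree (hpar : ∀ i, i ≠ 0 → par i < i) (h0 : dep 0 = 0)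
    (hdep : ∀ i, i ≠ 0 → dep i = dep (par i) + 1) : (parentGraph m par).IsTree := by
  have hconn := parentGraph_connected (m := m) hpar h0 hdep
  rw [isTree_iff_connected_and_card]
  refine ⟨hconn, le_antisymm ?_ hconn.card_vert_le_card_edgeSet_add_one⟩
  -- Every edge joins a nonzero vertex to its parent, so there are at most m edges.
  have hsub : (parentGraph m par).edgeSet ⊆
      (fun i : Fin m => s(i.succ, Fin.ofNat (m + 1) (par i.succ))) '' Set.univ := by
    intro e
    induction e with
    | _ a b =>
      have key : ∀ a b : Fin (m + 1), (a : ℕ) ≠ 0 → (b : ℕ) = par a → s(a, b) ∈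
          (fun i : Fin m => s(i.succ, Fin.ofNat (m + 1) (par i.succ))) '' Set.univ := by
        intro a b ha hb
        refine ⟨a.pred (fun e => ha (by rw [e]; rfl)), Set.mem_univ _, ?_⟩
        have : Fin.ofNat (m + 1) (par a) = b := by
          rw [← hb]; simp
        simp only [Fin.succ_pred, this]
      intro h
      rw [SimpleGraph.mem_edgeSet, parentGraph, SimpleGraph.fromRel_adj] at h
      rcases h.2 with ⟨h1, h2⟩ | ⟨h1, h2⟩
      · exact key a b h1 h2
      · rw [Sym2.eq_swap]; exact key b a h1 h2
  have h1 := Set.ncard_le_ncard hsub (Set.toFinite _)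
  have h2 := Set.ncard_image_le (f := fun i : Fin m => s(i.succ, Fin.ofNat (m + 1) (par i.succ)))
    (s := Set.univ)
  rw [Set.ncard_univ, Nat.card_eq_fintype_card, Fintype.card_fin] at h2
  rw [Nat.card_coe_set_eq, Nat.card_eq_fintype_card, Fintype.card_fin]
  omega

/-- A path with two more leaves, as a rooted tree with prescribed depths of the leaves. -/
theorem exists_tree_of_depths {M e₁ e₂ : ℕ} (h₁ : 1 ≤ e₁) (h₁' : e₁ ≤ M + 1) (h₂ : 1 ≤ e₂)
    (h₂' : e₂ ≤ M + 1) (g : ℕ) : ∃ (T : SimpleGraph (Fin (M + 3))) (r : Fin (M + 3)), T.IsTree ∧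
      ∑ t, (g + T.dist r t) = ∑ i ∈ range (M + 1), (g + i) + (g + e₁) + (g + e₂) := by
  -- The path is 0, …, M and the two leaves are M + 1 and M + 2. The values beyond only keep the
  -- depth recursion true on all of ℕ.
  let par : ℕ → ℕ := fun i => if i ≤ M then i - 1 else if i = M + 1 then e₁ - 1 else
    if i = M + 2 then e₂ - 1 else 0
  let dep : ℕ → ℕ := fun i => if i ≤ M then i else if i = M + 1 then e₁ else
    if i = M + 2 then e₂ else 1
  have hpar : ∀ i, i ≠ 0 → par i < i := by
    intro i hi
    simp only [par]
    split_ifs <;> omega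
  have h0 : dep 0 = 0 := by simp [dep]
  have hdep : ∀ i, i ≠ 0 → dep i = dep (par i) + 1 := by
    intro i hi
    simp only [par, dep]
    split_ifs <;> omega
  refine ⟨parentGraph (M + 2) par, 0, parentGraph_isTree hpar h0 hdep, ?_⟩
  have h3 : ∀ t : Fin (M + 3), g + (parentGraph (M + 2) par).dist 0 t = g + dep t := fun t => by
    rw [parentGraph_dist hpar h0 hdep t]
  rw [Finset.sum_congr rfl fun t _ => h3 t, Fin.sum_univ_eq_sum_range (fun i => g + dep i),
    Finset.sum_range_succ, Finset.sum_range_succ]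
  congr 1
  · congr 1
    · refine Finset.sum_congr rfl fun i hi => ?_
      rw [mem_range] at hi
      simp only [dep]
      rw [if_pos (by omega)]
    · simp [dep]
  · simp [dep]

/-- Every large number is the sum of `g + depth` over a rooted tree. -/
theorem exists_tree_sum_eq {g c : ℕ} (hc : ∑ i ∈ range (g + 3), (g + i) ≤ c) :
    ∃ (M : ℕ) (T : SimpleGraph (Fin (M + 3))) (r : Fin (M + 3)), T.IsTree ∧
      ∑ t, (g + T.dist r t) = c ∧ ∑ i ∈ range (M + 2), (g + i) ≤ c := by
  let P : ℕ → Prop := fun M => ∑ i ∈ range (M + 2), (g + i) ≤ c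
  have hmono : Monotone fun n => ∑ i ∈ range n, (g + i) :=
    fun a b hab => Finset.sum_le_sum_of_subset (range_subset_range.2 hab)
  have hle : ∀ M, M ≤ ∑ i ∈ range (M + 2), (g + i) := by
    intro M
    rw [Finset.sum_range_succ]
    omega
  have hg : P (g + 1) := hc
  have hg' : g + 1 ≤ c := (hle _).trans hc
  classical
  obtain ⟨M, hM⟩ : ∃ M, M = Nat.findGreatest P c := ⟨_, rfl⟩
  have h1 : P M := hM ▸ Nat.findGreatest_spec hg' hg
  have h2 : g + 1 ≤ M := hM ▸ Nat.le_findGreatest hg' hg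
  have h3 : ¬ P (M + 1) := by
    intro h
    by_cases h4 : M + 1 ≤ c
    · have := Nat.le_findGreatest h4 h
      omega
    · have := (hle (M + 1)).trans h
      omega
  simp only [P, not_le] at h1 h3
  have h5 := h1
  rw [Finset.sum_range_succ] at h1
  rw [Finset.sum_range_succ, Finset.sum_range_succ] at h3
  -- The two extra leaves must have depths with sum w. Maximality of M gives w ≤ 2M + 2, and M ≥ g +
  -- 1, which is what `hc` provides, gives w ≥ 2; so w splits into two depths between 1 and M + 1.
  obtain ⟨w, hw⟩ : ∃ w, c = ∑ i ∈ range (M + 1), (g + i) + 2 * g + w :=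
    ⟨c - (∑ i ∈ range (M + 1), (g + i) + 2 * g), by omega⟩
  obtain ⟨T, r, hT, hs⟩ := exists_tree_of_depths (M := M) (e₁ := min (w - 1) (M + 1))
    (e₂ := w - min (w - 1) (M + 1)) (by omega) (by omega) (by omega) (by omega) g
  refine ⟨M, T, r, hT, ?_, h5⟩
  rw [hs]
  omega

end RootedTrees

/-! ### Numerical estimates. -/

section Numerics

theorem pow_six_ge {h : ℕ} (hh : 29 ≤ h) : 10 ^ 11 * h ^ 2 ≤ 6 ^ h := by
  induction h, hh using Nat.le_induction with
  | base => norm_num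
  | succ h hh ih =>
    rw [pow_succ 6]
    nlinarith

theorem five_mul_sum_pow (h : ℕ) : 5 * ∑ k ∈ range h, 6 ^ k + 1 = 6 ^ h := by
  induction h with
  | zero => simp
  | succ h ih => rw [Finset.sum_range_succ, pow_succ]; omega

/-- For j = c = h the quadratic terms cancel and the factor of 6^h is 60h − 1694. It is positive
from h = 29 on, whence girth at least 58. -/
theorem sum_gainBound (c : ℤ) (j : ℕ) :
    125 * ∑ k ∈ range j, (6 : ℤ) ^ k * (gainBound (2 * c) (2 * k)
      + 7 * gainBound (2 * c) (2 * k + 1) + 6 * gainBound (2 * c) (2 * k + 2)) =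
      6 ^ j * (-2800 * (j : ℤ) ^ 2 + (2800 * c + 2920) * j - 2860 * c - 1694)
        + 2860 * c + 1694 := by
  induction j with
  | zero => simp; ring
  | succ j ih =>
    rw [Finset.sum_range_succ, mul_add, ih, gainBound, gainBound, gainBound]
    push_cast
    ring

theorem two_mul_sum_range_add (g L : ℕ) :
    2 * ∑ i ∈ range (L + 1), (g + i) = (L + 1) * (2 * g + L) := by
  induction L with
  | zero => simp
  | succ L ih => rw [Finset.sum_range_succ, mul_add, ih]; ring

/-- The total gain is large. -/
theorem le_totalGain {h n N : ℕ} (hh : 29 ≤ h) (hN : N = 2 * ∑ k ∈ range h, 6 ^ k)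
    (hn : (n : ℝ) ≤ 1.0005 * N) :
    2 * ((∑ i ∈ range (2 * h + 3), (2 * h + i) : ℕ) : ℤ) ≤
      ∑ k ∈ range h, (6 : ℤ) ^ k * (gainBound (2 * h : ℕ) (2 * k)
      + 7 * gainBound (2 * h : ℕ) (2 * k + 1) + 6 * gainBound (2 * h : ℕ) (2 * k + 2))
      - 28 * (2 * h : ℕ) * ((n : ℤ) - N) := by
  have h1 := sum_gainBound h h
  have h2 := two_mul_sum_range_add (2 * h) (2 * h + 2)
  have h3 := five_mul_sum_pow h
  have h4 := pow_six_ge hh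
  push_cast
  set S := ∑ k ∈ range h, (6 : ℤ) ^ k * (gainBound (2 * h) (2 * k)
      + 7 * gainBound (2 * h) (2 * k + 1) + 6 * gainBound (2 * h) (2 * k + 2))
  set Q := ∑ k ∈ range h, 6 ^ k
  zify at h2 h3 h4
  set P := ∑ i ∈ range (2 * h + 3), (2 * (h : ℤ) + i)
  have h5 : (5 * (N : ℤ)) = 2 * (6 ^ h - 1) := by
    rw [hN, ← h3]; push_cast; ring
  have h6 : 2000 * (n : ℤ) ≤ 2001 * N := by
    have : (2000 : ℝ) * n ≤ 2001 * N := by linarith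
    exact_mod_cast this
  have h7 : (29 : ℤ) ≤ h := by exact_mod_cast hh
  generalize (6 : ℤ) ^ h = E at *
  have h8 : 125 * S = E * (60 * h - 1694) + 2860 * h + 1694 := by rw [h1]; ring
  have h9 : 2 * P = (2 * h + 3) * (2 * (2 * h) + (2 * h + 2)) := by
    rw [h2]; ring
  -- Scaled by 125, the loss outside the ball is at most 1.4·h·E, that is 40.6·E against the gain
  -- 46·E at h = 29. The surplus outweighs the quadratic term 2P by `pow_six_ge`.
  have h10 : 28 * (2 * (h : ℤ)) * (2000 * ((n : ℤ) - N)) ≤ 28 * (2 * h) * N := by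
    apply mul_le_mul_of_nonneg_left <;> linarith
  have h11 : 28 * (2 * (h : ℤ)) * (10000 * ((n : ℤ) - N)) ≤ 28 * (2 * h) * (2 * E) := by
    have : 28 * (2 * (h : ℤ)) * (5 * N) ≤ 28 * (2 * h) * (2 * E) := by
      apply mul_le_mul_of_nonneg_left <;> linarith
    linarith
  nlinarith

/-- The sum bound gives (M + 2)(2g + M + 1) ≤ 2c, hence (M + 3)² ≤ 2c + 1 ≤ 28ng² + 1 ≤ 36g²N. -/
theorem treeOrder_le {g M c N n : ℕ} (hg : 58 ≤ g) (hM : ∑ i ∈ range (M + 2), (g + i) ≤ c)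
    (hc : c ≤ 14 * n * g ^ 2) (hn : (n : ℝ) ≤ 1.0005 * N) (hN : 1 ≤ N) :
    ((M + 3 : ℕ) : ℝ) ≤ 6 * g * √(N : ℝ) := by
  have h1 := two_mul_sum_range_add g (M + 1)
  have h2 : (M + 3) ^ 2 ≤ 2 * c + 1 := by nlinarith
  have h3 : ((M + 3 : ℕ) : ℝ) ^ 2 ≤ 36 * g ^ 2 * N := by
    have h4 : (((M + 3) ^ 2 : ℕ) : ℝ) ≤ 2 * (14 * n * g ^ 2) + 1 := by
      exact_mod_cast h2.trans (by omega)
    have h5 : (0 : ℝ) ≤ (g : ℝ) ^ 2 := by positivity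
    have h6 : (n : ℝ) * g ^ 2 ≤ 1.0005 * N * g ^ 2 := mul_le_mul_of_nonneg_right hn h5
    have h7 : (1 : ℝ) ≤ N * g ^ 2 := by
      have : 1 ≤ N * g ^ 2 := Nat.one_le_iff_ne_zero.2 (by positivity)
      exact_mod_cast this
    push_cast at h4 ⊢
    linarith
  have h8 : 6 * (g : ℝ) * √(N : ℝ) = √(36 * g ^ 2 * N) := by
    rw [Real.sqrt_mul (by positivity), show (36 * (g : ℝ) ^ 2) = (6 * g) ^ 2 by ring,
      Real.sqrt_sq (by positivity)]
  rw [h8]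
  exact Real.le_sqrt_of_sq_le h3

theorem fraction_bounds {g m n N : ℕ} {L : ℝ} (hN : 1 ≤ N) (hNn : N ≤ n)
    (hn : (n : ℝ) ≤ 1.0005 * N) (hL : 12 * (N : ℝ) - 7 * n ≤ L)
    (hm : (m : ℝ) ≤ 6 * g * √(N : ℝ)) (hgN : 25 * 10 ^ 8 * (g : ℝ) ^ 2 ≤ N) :
    5 / 7 - 12 / 7 * (1 - (N : ℝ) / n) - g / √(N : ℝ) ≤ L / (7 * n + m) ∧
    0.7134 < L / (7 * n + m) := by
  have hN' : (1 : ℝ) ≤ N := by exact_mod_cast hN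
  have hNn' : (N : ℝ) ≤ n := by exact_mod_cast hNn
  have hn0 : (0 : ℝ) < n := by linarith
  have hs0 : 0 < √(N : ℝ) := Real.sqrt_pos.2 (by linarith)
  have hss : √(N : ℝ) * √(N : ℝ) = N := Real.mul_self_sqrt (by linarith)
  have hm0 : (0 : ℝ) ≤ m := by positivity
  have key : 5 / 7 - 12 / 7 * (1 - (N : ℝ) / n) - g / √(N : ℝ) ≤ L / (7 * n + m) := by
    rw [le_div_iff₀ (by positivity)]
    have h1 : (5 : ℝ) / 7 - 12 / 7 * (1 - (N : ℝ) / n) = (12 * N - 7 * n) / (7 * n) := by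
      field_simp; ring
    have h2 : (m : ℝ) / (7 * n) ≤ g / √(N : ℝ) := by
      rw [div_le_div_iff₀ (by positivity) hs0]
      have h3 : (m : ℝ) * √(N : ℝ) ≤ 6 * g * √(N : ℝ) * √(N : ℝ) :=
        mul_le_mul_of_nonneg_right hm hs0.le
      rw [mul_assoc, hss] at h3
      have h4 : (g : ℝ) * N ≤ g * n := mul_le_mul_of_nonneg_left hNn' (by positivity)
      have h5 : (0 : ℝ) ≤ g * n := by positivity
      linarith
    rw [h1]
    have h3 : ((12 * N - 7 * n) / (7 * n) - g / √(N : ℝ)) * (7 * n + m) ≤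
        ((12 * N - 7 * n) / (7 * n) - (m : ℝ) / (7 * n)) * (7 * n + m) :=
      mul_le_mul_of_nonneg_right (by linarith) (by positivity)
    refine h3.trans (le_trans ?_ hL)
    -- With X = 12N − 7n ≤ Y = 7n this is (X − m)(Y + m) ≤ XY.
    rw [← sub_div, div_mul_eq_mul_div, div_le_iff₀ (by positivity)]
    nlinarith
  refine ⟨key, lt_of_lt_of_le ?_ key⟩
  have h1 : (1 : ℝ) / 1.0005 ≤ N / n := by
    rw [div_le_div_iff₀ (by norm_num) hn0]; linarith
  -- The two losses are below 0.000857 and at most 0.00002, which leaves more than 0.7134 of 5/7.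
  have h2 : (g : ℝ) / √(N : ℝ) ≤ 1 / 50000 := by
    rw [div_le_div_iff₀ hs0 (by norm_num), one_mul]
    refine Real.le_sqrt_of_sq_le ?_
    nlinarith
  norm_num at h1 ⊢
  linarith

end Numerics

end Soltes

/-! ### Assembly. -/

open Soltes in
theorem mainTheorem6 {V : Type*} [Fintype V] (G : SimpleGraph V) [DecidableRel G.Adj]
    (hconn : G.Connected) (hreg : G.IsRegularOfDegree 7) (harc : IsArcTransitive G)
    (heven : Even G.girth) (hgirth : 58 ≤ G.girth)
    (hcard : (Fintype.card V : ℝ) ≤ 1.0005 * (mooreBound 7 G.girth : ℝ)) :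
    ∃ (n : ℕ) (T : SimpleGraph (Fin n)) (r : Fin n),
      T.IsTree ∧
      (n : ℝ) ≤ 6 * (G.girth : ℝ) * √(mooreBound 7 G.girth : ℝ) ∧
      ∀ a : G.Dart,
        (attachAt (arcGraph G) a a.symm T r).Connected ∧
        5 / 7 - 12 / 7 * (1 - (mooreBound 7 G.girth : ℝ) / (Fintype.card V : ℝ))
            - (G.girth : ℝ) / √(mooreBound 7 G.girth : ℝ)
          ≤ soltesFraction (attachAt (arcGraph G) a a.symm T r) ∧
        0.7134 < soltesFraction (attachAt (arcGraph G) a a.symm T r) := by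
  classical
  obtain ⟨h, hh⟩ := heven
  replace hh : G.girth = 2 * h := by omega
  have h29 : 29 ≤ h := by omega
  have h2 : 2 ≤ h := by omega
  have hne : Nonempty G.Dart := by
    obtain ⟨v⟩ := hconn.nonempty
    obtain ⟨w, hw⟩ := (G.degree_pos_iff_exists_adj v).1 (by rw [hreg v]; norm_num)
    exact ⟨⟨(v, w), hw⟩⟩
  obtain ⟨d₀⟩ := id hne
  have hN := mooreBound_eq hh
  have hNn := mooreBound_le_card hh hreg d₀
  have hpow := five_mul_sum_pow h
  have hpow' := pow_six_ge h29
  have hNpow : 25 * 10 ^ 8 * G.girth ^ 2 ≤ mooreBound 7 G.girth := by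
    rw [hN, hh]; nlinarith
  have hN1 : 1 ≤ mooreBound 7 G.girth := by nlinarith
  have hn2 : Fintype.card V < 2 * mooreBound 7 G.girth := by
    have : (1 : ℝ) ≤ (mooreBound 7 G.girth : ℝ) := by exact_mod_cast hN1
    have : (Fintype.card V : ℝ) < 2 * (mooreBound 7 G.girth : ℝ) := by linarith
    exact_mod_cast this
  have hdet := IsArcTransitive.hasDetours harc (by omega)
  have hdel := fun v => hdet.connected_induce_compl hconn v
  obtain ⟨c, hc, hsum⟩ := exists_wienerIndex_sub_eq (G := G) harc
  have hD : Fintype.card G.Dart = 7 * Fintype.card V := card_dart hreg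
  have hDpos : (0 : ℤ) < Fintype.card G.Dart := by exact_mod_cast Fintype.card_pos
  have hclow : ((∑ i ∈ Finset.range (G.girth + 3), (G.girth + i) : ℕ) : ℤ) ≤ c := by
    have h3 : ∀ x ∈ Finset.univ, _ := fun (x : G.Dart) (_ : x ∈ Finset.univ) =>
      (le_totalGain h29 (hh ▸ hN) (hh ▸ hcard)).trans
        (hh ▸ le_sum_delGain hconn hdel hreg hh h2 hn2 x)
    have h4 := Finset.card_nsmul_le_sum _ _ _ h3
    rw [← hsum, Finset.card_univ, nsmul_eq_mul] at h4
    have h5 := le_of_mul_le_mul_left h4 hDpos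
    rw [hh]
    linarith
  -- An ordered pair gains at most (2g + 1)(2g − 2) ≤ 4g², so 2c ≤ 7n·4g².
  have hcup : c ≤ 14 * Fintype.card V * (G.girth : ℤ) ^ 2 := by
    have h3 : ∀ x ∈ (Finset.univ : Finset G.Dart), ∀ y ∈ (Finset.univ : Finset G.Dart), delGain y x ≤ 4 * (G.girth : ℤ) ^ 2 := by
      intro x _ y _
      have h4 := hdet.delGain_le hconn (by omega) y x
      have h5 := dist_le_two_mul_girth hconn hh h2 hreg hn2 y x
      zify at h5
      have h6 : (58 : ℤ) ≤ G.girth := by exact_mod_cast hgirth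
      nlinarith
    have h4 := Finset.sum_le_card_nsmul _ _ _ fun x hx =>
      Finset.sum_le_card_nsmul _ _ _ (h3 x hx)
    rw [← hsum, Finset.card_univ, nsmul_eq_mul, nsmul_eq_mul] at h4
    have h5 := le_of_mul_le_mul_left h4 hDpos
    rw [hD] at h5
    push_cast at h5
    linarith
  obtain ⟨c, rfl⟩ := Int.eq_ofNat_of_zero_le ((Int.natCast_nonneg _).trans hclow)
  obtain ⟨M, T, r, hT, hTc, hTM⟩ := exists_tree_sum_eq (g := G.girth) (c := c)
    (by exact_mod_cast hclow)
  have hm := treeOrder_le hgirth hTM (by exact_mod_cast hcup) hcard hN1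
  -- The tree depends only on g and c, so it serves every edge.
  refine ⟨M + 3, T, r, hT, hm, fun a => ?_⟩
  have hA := arcGraph_connected hconn
  refine ⟨attachAt_connected hA hT.1, ?_⟩
  have hadj : (arcGraph G).Adj a a.symm := ⟨a.symm_ne.symm, Or.inr rfl⟩
  have hsol : ∀ v ∈ innerLeaves h a,
      IsSoltesVertex (attachAt (arcGraph G) a a.symm T r) (Sum.inl v) := by
    intro v hv
    obtain ⟨h3, h4, h5, h6⟩ := innerLeaf_spec hconn hdel hh h2 hv
    refine isSoltesVertex_attachAt hA hT.1 hadj h3 h4 (hdel v) h6 ?_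
    rw [hc v, ← hTc]
    push_cast
    refine Finset.sum_congr rfl fun t _ => ?_
    -- The distance g − 1 and the joining edge add up to the g in the sum that defines `T`.
    zify [show 1 ≤ G.girth by omega] at h5
    rw [h5]
    ring
  have hL : 12 * (mooreBound 7 G.girth : ℝ) - 7 * Fintype.card V ≤
      ({v | IsSoltesVertex (attachAt (arcGraph G) a a.symm T r) v}.ncard : ℝ) := by
    have h3 : (innerLeaves h a).card ≤
        {v | IsSoltesVertex (attachAt (arcGraph G) a a.symm T r) v}.ncard := by
      rw [← Finset.card_image_of_injective _ (Sum.inl_injective (β := Fin (M + 3))),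
        ← Set.ncard_coe_finset]
      refine Set.ncard_le_ncard ?_ (Set.toFinite _)
      intro z hz
      obtain ⟨v, hv, rfl⟩ := Finset.mem_image.1 (Finset.mem_coe.1 hz)
      exact hsol v hv
    have h4 := card_innerLeaves hh h2 hreg a
    have h5 := five_mul_mooreBound_le hh h2
    have h6 : 12 * mooreBound 7 G.girth ≤
        {v | IsSoltesVertex (attachAt (arcGraph G) a a.symm T r) v}.ncard
          + 7 * Fintype.card V := by omega
    have h7 : (12 * mooreBound 7 G.girth : ℝ) ≤
        {v | IsSoltesVertex (attachAt (arcGraph G) a a.symm T r) v}.ncard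
          + 7 * Fintype.card V := by exact_mod_cast h6
    linarith
  have hfr := fraction_bounds hN1 hNn hcard hL hm (by exact_mod_cast hNpow)
  have hcardH : (Nat.card (G.Dart ⊕ Fin (M + 3)) : ℝ)
      = 7 * Fintype.card V + ((M + 3 : ℕ) : ℝ) := by
    rw [Nat.card_eq_fintype_card, Fintype.card_sum, hD, Fintype.card_fin]
    push_cast
    ring
  rw [soltesFraction, hcardH]
  exact hfr
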